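/- **Theorem (regularity bootstrap).** Let $(\Omega,\mathscr F,\mathbb P)$ be a probability space and $\Phi:\Omega\to\Omega$ a measurable bijection with measurable inverse that preserves $\mathbb P$ (for instance the time-one Wiener shift on Wiener space). Let $\mathbb T^m=\mathbb R^m/\mathbb Z^m$, $\alpha\in\mathbb R^m$, $r\in\mathbb N=\{0,1,2,\dots\}$, and let $U\subset\mathbb R^n$ be open. A jointly measurable map $G:\mathbb T^m\times\Omega\to\mathbb R^n$ (respectively $G:U\times\mathbb T^m\times\Omega\to\mathbb R^n$) is called $\mathcal L^\infty(C^r)$ if for a.e. $\omega$ the map $G(\cdot,\omega)$ (respectively $G(\cdot,\cdot,\omega)$, jointly in all its variables) is $C^r$, and its derivatives of all orders $0\le k\le r$ are bounded by a constant that does not depend on the point or on $\omega$, for a.e. $\omega$. Let $F:U\times\mathbb T^m\times\Omega\to\mathbb R^n$ be $\mathcal L^\infty(C^r)$, such that for a.e. $\omega$ and all $\theta$ the map $F(\cdot,\theta,\omega):U\to\mathbb R^n$ is a local diffeomorphism. If $r=1$, assume also that $D_zF$ is uniformly continuous in $z\in U$, with a modulus of continuity independent of $\theta$ and of (a.e.)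 $\omega$. Let $K:\mathbb T^m\times\Omega\to U$ be $\mathcal L^\infty(C^0)$. Assume that $U$ is convex (for example $U=\mathbb R^n$), or that for some $\rho>0$ and a.e. $\omega$ all balls of radius $\rho$ centred at points $K(\theta,\omega)$ lie in $U$. Suppose that $K$ parameterizes a normally hyperbolic random invariant torus of the random skew-product $(z,\theta,\omega)\mapsto(F(z,\theta,\omega),\theta+\alpha,\Phi\omega)$, that is: 1. $F(K(\theta,\omega),\theta,\omega)=K(\theta+\alpha,\Phi\omega)$ for a.e. $\omega$ and all $\theta$; 2. with $M(\theta,\omega)=D_zF(K(\theta,\omega),\theta,\omega)$ and its cocycle $$M(\theta,\omega,N)=\begin{cases}M(\theta+(N-1)\alpha,\Phi^{N-1}\omega)\cdots M(\theta,\omega),&N>0,\\ \mathrm{Id},&N=0,\\ M(\theta+N\alpha,\Phi^{N}\omega)^{-1}\cdots M(\theta-\alpha,\Phi^{-1}\omega)^{-1},&N<0,\end{cases}$$ there are constants $C>0$, $0<\lambda_S<1<\lambda_U$ and splittings $\mathbb R^n=\mathscr E^S(\theta,\omega)\oplus\mathscr E^U(\theta,\omega)$, whose projections are measurable in $\omega$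 for each $\theta$, such that for a.e. $\omega$ the projections are continuous in $\theta$ and, for all $\theta$, one has $M(\theta,\omega)\mathscr E^{S}(\theta,\omega)\subset\mathscr E^{S}(\theta+\alpha,\Phi\omega)$, $M(\theta,\omega)\mathscr E^{U}(\theta,\omega)\subset\mathscr E^{U}(\theta+\alpha,\Phi\omega)$, and - $v\in\mathscr E^S(\theta,\omega)$ if and only if $|M(\theta,\omega,N)v|\le C\lambda_S^N|v|$ for all $N\ge0$; - $v\in\mathscr E^U(\theta,\omega)$ if and only if $|M(\theta,\omega,N)v|\le C\lambda_U^N|v|$ for all $N\le0$. Then $K$ is $\mathcal L^\infty(C^r)$. -/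

import Mathlib

open MeasureTheory Set
open scoped Manifold

noncomputable section

namespace RandomTorus

/-- The phase space `ℝⁿ` with its Euclidean norm. -/
abbrev Space (n : ℕ) : Type := EuclideanSpace ℝ (Fin n)

/-- The torus `𝕋ᵐ = (ℝ/ℤ)ᵐ`. -/
abbrev Torus (m : ℕ) : Type := UnitAddTorus (Fin m)

/-- The covering map `ℝᵐ → 𝕋ᵐ`. Derivatives in `θ ∈ 𝕋ᵐ` are taken through this map. -/
def toTorus {m : ℕ} (x : Space m) : Torus m := fun i => ((x i : ℝ) : UnitAddCircle)

section Regularity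

variable {Ω : Type*} [MeasurableSpace Ω]

/-- The class `L^∞(Ω, C^r(𝕋ᵐ, ℝⁿ))`: jointly measurable maps that are `C^r` in `θ` for almost every
`ω`, with all derivatives of order at most `r` essentially bounded. -/
def IsLinftyCr (P : Measure Ω) {n m : ℕ} (r : ℕ) (K : Torus m → Ω → Space n) : Prop :=
  Measurable (fun p : Torus m × Ω => K p.1 p.2) ∧
  (∀ᵐ ω ∂P, ContDiff ℝ r (fun x : Space m => K (toTorus x) ω)) ∧
  ∃ B : ℝ, ∀ᵐ ω ∂P, ∀ k : ℕ, k ≤ r → ∀ x : Space m,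
    ‖iteratedFDeriv ℝ k (fun x : Space m => K (toTorus x) ω) x‖ ≤ B

/-- The class `L^∞(Ω, C^r(U × 𝕋ᵐ, ℝⁿ))`, jointly `C^r` in `(z, θ)`, for an open set `U`.
Only the values of `F` on `U × 𝕋ᵐ × Ω` matter. -/
def IsLinftyCrOn (P : Measure Ω) {n m : ℕ} (r : ℕ) (U : Set (Space n))
    (F : Space n → Torus m → Ω → Space n) : Prop :=
  Measurable (fun p : U × Torus m × Ω => F p.1 p.2.1 p.2.2) ∧
  (∀ᵐ ω ∂P, ContDiffOn ℝ r (fun p : Space n × Space m => F p.1 (toTorus p.2) ω) (U ×ˢ univ)) ∧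
  ∃ B : ℝ, ∀ᵐ ω ∂P, ∀ k : ℕ, k ≤ r → ∀ z ∈ U, ∀ x : Space m,
    ‖iteratedFDeriv ℝ k (fun p : Space n × Space m => F p.1 (toTorus p.2) ω) (z, x)‖ ≤ B

/-- `D_z F` has a modulus of continuity in `z ∈ U` that does not depend on `θ` or `ω`. -/
def HasUniformModulusFDeriv (P : Measure Ω) {n m : ℕ} (U : Set (Space n))
    (F : Space n → Torus m → Ω → Space n) : Prop :=
  ∀ η : ℝ, 0 < η → ∃ δ : ℝ, 0 < δ ∧ ∀ᵐ ω ∂P, ∀ θ : Torus m, ∀ z ∈ U, ∀ z' ∈ U,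
    ‖z - z'‖ < δ →
      ‖fderiv ℝ (fun y => F y θ ω) z - fderiv ℝ (fun y => F y θ ω) z'‖ ≤ η

end Regularity

section Hyperbolicity

variable {Ω : Type*} [MeasurableSpace Ω]

/-- The transfer matrix `M(θ, ω) = D_z F(K(θ, ω), θ, ω)`. -/
def transferMatrix {n m : ℕ} (F : Space n → Torus m → Ω → Space n) (K : Torus m → Ω → Space n)
    (θ : Torus m) (ω : Ω) : Space n →L[ℝ] Space n :=
  fderiv ℝ (fun z => F z θ ω) (K θ ω)

/-- `M(θ + (N-1)α, Φ^(N-1) ω) ⋯ M(θ, ω)`. -/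
def forwardCocycle {n m : ℕ} (Φ : Ω ≃ᵐ Ω) (α : Space m)
    (M : Torus m → Ω → Space n →L[ℝ] Space n) (θ : Torus m) (ω : Ω) :
    ℕ → (Space n →L[ℝ] Space n)
  | 0 => ContinuousLinearMap.id ℝ (Space n)
  | N + 1 => (M (θ + N • toTorus α) (Φ^[N] ω)).comp (forwardCocycle Φ α M θ ω N)

/-- `M(θ - Nα, Φ^(-N) ω)⁻¹ ⋯ M(θ - α, Φ⁻¹ ω)⁻¹`. -/
def backwardCocycle {n m : ℕ} (Φ : Ω ≃ᵐ Ω) (α : Space m)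
    (M : Torus m → Ω → Space n →L[ℝ] Space n) (θ : Torus m) (ω : Ω) :
    ℕ → (Space n →L[ℝ] Space n)
  | 0 => ContinuousLinearMap.id ℝ (Space n)
  | N + 1 => (M (θ - (N + 1) • toTorus α) (Φ.symm^[N + 1] ω)).inverse.comp
      (backwardCocycle Φ α M θ ω N)

/-- The cocycle `M(θ, ω, N)`, `N ∈ ℤ`, of the linear skew-product `(M, α, Φ)`. -/
def cocycle {n m : ℕ} (Φ : Ω ≃ᵐ Ω) (α : Space m)
    (M : Torus m → Ω → Space n →L[ℝ] Space n) (θ : Torus m) (ω : Ω) :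
    ℤ → (Space n →L[ℝ] Space n)
  | Int.ofNat N => forwardCocycle Φ α M θ ω N
  | Int.negSucc N => backwardCocycle Φ α M θ ω (N + 1)

/-- The linear skew-product `(M, α, Φ)` is normally hyperbolic: there is an invariant splitting
`ℝⁿ = E^S(θ, ω) ⊕ E^U(θ, ω)`, continuous in `θ` and measurable in `ω` through its projections,
with the stable and the unstable bundle characterized by exponential rates. -/
def IsNormallyHyperbolicCocycle (P : Measure Ω) {n m : ℕ} (Φ : Ω ≃ᵐ Ω) (α : Space m)
    (M : Torus m → Ω → Space n →L[ℝ] Space n) : Prop :=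
  ∃ (ES EU : Torus m → Ω → Submodule ℝ (Space n))
    (projS projU : Torus m → Ω → Space n →L[ℝ] Space n) (C lamS lamU : ℝ),
    0 < C ∧ 0 < lamS ∧ lamS < 1 ∧ 1 < lamU ∧
    (∀ θ, Measurable (projS θ)) ∧ (∀ θ, Measurable (projU θ)) ∧
    ∀ᵐ ω ∂P,
      Continuous (fun θ => projS θ ω) ∧ Continuous (fun θ => projU θ ω) ∧
      ∀ θ : Torus m,
        IsCompl (ES θ ω) (EU θ ω) ∧
        (∀ v, projS θ ω v ∈ ES θ ω ∧ projU θ ω v ∈ EU θ ω ∧ projS θ ω v + projU θ ω v = v) ∧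
        (∀ v, v ∈ ES θ ω ↔
          ∀ N : ℤ, 0 ≤ N → ‖cocycle Φ α M θ ω N v‖ ≤ C * lamS ^ N * ‖v‖) ∧
        (∀ v, v ∈ EU θ ω ↔
          ∀ N : ℤ, N ≤ 0 → ‖cocycle Φ α M θ ω N v‖ ≤ C * lamU ^ N * ‖v‖) ∧
        (∀ v ∈ ES θ ω, M θ ω v ∈ ES (θ + toTorus α) (Φ ω)) ∧
        (∀ v ∈ EU θ ω, M θ ω v ∈ EU (θ + toTorus α) (Φ ω))

/-- `K` parameterizes a normally hyperbolic random invariant torus of the random skew-product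
`(z, θ, ω) ↦ (F(z, θ, ω), θ + α, Φ ω)`. -/
def IsNormallyHyperbolicInvariantTorus (P : Measure Ω) {n m : ℕ} (Φ : Ω ≃ᵐ Ω) (α : Space m)
    (F : Space n → Torus m → Ω → Space n) (K : Torus m → Ω → Space n) : Prop :=
  (∀ᵐ ω ∂P, ∀ θ : Torus m, F (K θ ω) θ ω = K (θ + toTorus α) (Φ ω)) ∧
  IsNormallyHyperbolicCocycle P Φ α (transferMatrix F K)

end Hyperbolicity

end RandomTorus

end

/-! Fix `ω` and lift `θ` to `x ∈ ℝᵐ`. Along the orbit the torus is a bounded sequence `K_k(x)` with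
`K_{k+1}(x) = f_k(K_k(x), x)`, and hyperbolicity says that the linearization `A_k` has a dichotomy:
`w_{k+1} = A_k w_k + g_k` has exactly one bounded solution for bounded `g`, with an exponentially
decaying Green kernel (`IsDichotomous`, obtained from the splitting in
`exists_isDichotomous_of_splitting`). The constants depend only on the rates and on a bound for
`‖A_k‖`, hence not on `ω`.

The difference `K_k(y) - K_k(x)` solves such an equation, with forcing a remainder `η |K_k(y) -
K_k(x)|`, valid where that difference is small, plus `O(|y - x|)`. If the differences were small for
all `k` at once, absorbing the remainder would give a Lipschitz bound. But `K` is only continuous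
for each `ω`, with no modulus uniform along the orbit. Poincaré recurrence supplies one at times
unbounded in both directions (`ae_exists_recurrent_windows`). Between two such times, a scale on
which the differences are small can be doubled repeatedly, because the Green kernel improves
smallness by a factor two. This is `exists_uniform_lipschitz`: the Lipschitz constant is
deterministic, only the scale on which it holds depends on `ω`.

Once `K` is locally Lipschitz, the difference quotients converge to the bounded solution of the
formally differentiated equation. That equation is linear with coefficients as smooth as `K`, and
`isUniformlyCk_of_linear` gives its solution the same smoothness, so `K` gains one derivative at
each round, up to order `r` (`isUniformlyCk_of_invariant`). -/

open Filter Topology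

namespace RandomTorus

/-! ### Bounded solutions of linear difference equations over `ℤ`. -/

section Dichotomy

variable {E : Type*} [NormedAddCommGroup E] [NormedSpace ℝ E]

theorem summable_pow_natAbs {μ : ℝ} (h0 : 0 ≤ μ) (h1 : μ < 1) :
    Summable (fun i : ℤ => μ ^ i.natAbs) := by
  apply Summable.of_nat_of_neg
  · simpa using summable_geometric_of_lt_one h0 h1
  · simpa using summable_geometric_of_lt_one h0 h1

theorem summable_pow_natAbs_sub {μ : ℝ} (h0 : 0 ≤ μ) (h1 : μ < 1) (k : ℤ) :
    Summable (fun j : ℤ => μ ^ (k - j).natAbs) :=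
  (summable_pow_natAbs h0 h1).comp_injective (Equiv.subLeft k).injective

theorem tsum_pow_natAbs_sub (μ : ℝ) (k : ℤ) :
    ∑' j : ℤ, μ ^ (k - j).natAbs = ∑' i : ℤ, μ ^ i.natAbs :=
  (Equiv.subLeft k).tsum_eq (fun i : ℤ => μ ^ i.natAbs)

theorem summable_pow_natAbs_mul {μ : ℝ} (h0 : 0 ≤ μ) (h1 : μ < 1) (k : ℤ) {a : ℤ → ℝ} {b : ℝ}
    (ha0 : ∀ j, 0 ≤ a j) (ha : ∀ j, a j ≤ b) :
    Summable (fun j : ℤ => μ ^ (k - j).natAbs * a j) :=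
  Summable.of_nonneg_of_le (fun j => mul_nonneg (pow_nonneg h0 _) (ha0 j))
    (fun j => mul_le_mul_of_nonneg_left (ha j) (pow_nonneg h0 _))
    ((summable_pow_natAbs_sub h0 h1 k).mul_right b)

/-- Fixes the window radius beyond which the Green kernel carries negligible mass. -/
theorem exists_tail_lt {μ : ℝ} (h0 : 0 ≤ μ) (h1 : μ < 1) {ε : ℝ} (hε : 0 < ε) :
    ∃ N : ℕ, ∑' i : ℤ, μ ^ i.natAbs * (if N < i.natAbs then (1 : ℝ) else 0) < ε := by
  have : Tendsto (fun N : ℕ => ∑' i : ℤ, μ ^ i.natAbs * (if N < i.natAbs then (1 : ℝ) else 0))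
      atTop (𝓝 (∑' i : ℤ, (0 : ℝ))) := by
    refine tendsto_tsum_of_dominated_convergence (summable_pow_natAbs h0 h1) ?_ ?_
    · intro i
      refine tendsto_const_nhds.congr' ?_
      filter_upwards [eventually_ge_atTop i.natAbs] with N hN
      simp [not_lt.2 hN]
    · refine Eventually.of_forall fun N i => ?_
      rw [norm_mul, Real.norm_of_nonneg (pow_nonneg h0 _)]
      refine mul_le_of_le_one_right (pow_nonneg h0 _) ?_
      split_ifs <;> simp
  rw [tsum_zero] at this
  exact (this.eventually (gt_mem_nhds hε)).exists

/-- The linear difference equation `w (k+1) = A k (w k) + g k` has a unique bounded solution for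
each bounded `g`, and it is controlled by an exponentially decaying Green kernel. -/
structure IsDichotomous (A : ℤ → E →L[ℝ] E) (C μ : ℝ) : Prop where
  const_nonneg : 0 ≤ C
  rate_nonneg : 0 ≤ μ
  rate_lt_one : μ < 1
  norm_le_tsum : ∀ w g : ℤ → E, (∃ b, ∀ k, ‖w k‖ ≤ b) → (∃ b, ∀ k, ‖g k‖ ≤ b) →
    (∀ k, w (k + 1) = A k (w k) + g k) →
    ∀ k, ‖w k‖ ≤ C * ∑' j, μ ^ (k - j).natAbs * ‖g j‖
  exists_solution : ∀ g : ℤ → E, (∃ b, ∀ k, ‖g k‖ ≤ b) →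
    ∃ w : ℤ → E, (∃ b, ∀ k, ‖w k‖ ≤ b) ∧ ∀ k, w (k + 1) = A k (w k) + g k

namespace IsDichotomous

variable {A : ℤ → E →L[ℝ] E} {C μ : ℝ}

theorem norm_le (h : IsDichotomous A C μ) {w g : ℤ → E} {b : ℝ} (hw : ∃ b, ∀ k, ‖w k‖ ≤ b)
    (hg : ∀ k, ‖g k‖ ≤ b) (heq : ∀ k, w (k + 1) = A k (w k) + g k) (k : ℤ) :
    ‖w k‖ ≤ C * (∑' i : ℤ, μ ^ i.natAbs) * b := by
  refine (h.norm_le_tsum w g hw ⟨b, hg⟩ heq k).trans ?_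
  rw [mul_assoc]
  refine mul_le_mul_of_nonneg_left ?_ h.const_nonneg
  rw [← tsum_pow_natAbs_sub μ k, ← tsum_mul_right]
  exact Summable.tsum_le_tsum
    (fun j => mul_le_mul_of_nonneg_left (hg j) (pow_nonneg h.rate_nonneg _))
    (summable_pow_natAbs_mul h.rate_nonneg h.rate_lt_one k (fun _ => norm_nonneg _) hg)
    ((summable_pow_natAbs_sub h.rate_nonneg h.rate_lt_one k).mul_right b)

theorem eq_zero (h : IsDichotomous A C μ) {w : ℤ → E} (hw : ∃ b, ∀ k, ‖w k‖ ≤ b)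
    (heq : ∀ k, w (k + 1) = A k (w k)) (k : ℤ) : w k = 0 := by
  have := h.norm_le (g := fun _ => 0) (b := 0) hw (by simp) (by simpa using heq) k
  simpa using this

/-- Dominated convergence against the Green kernel: the forcing needs a common bound but has to
converge only for each `k` separately, so no continuity uniform along the orbit is required. -/
theorem tendsto_zero (h : IsDichotomous A C μ) {Y : Type*} {l : Filter Y} {w g : Y → ℤ → E}
    {b : ℝ} (hw : ∀ᶠ y in l, ∃ b, ∀ k, ‖w y k‖ ≤ b) (hg : ∀ᶠ y in l, ∀ k, ‖g y k‖ ≤ b)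
    (heq : ∀ᶠ y in l, ∀ k, w y (k + 1) = A k (w y k) + g y k)
    (hlim : ∀ k, Tendsto (fun y => g y k) l (𝓝 0)) (k : ℤ) :
    Tendsto (fun y => w y k) l (𝓝 0) := by
  have h1 : Tendsto (fun y => C * ∑' j, μ ^ (k - j).natAbs * ‖g y j‖) l
      (𝓝 (C * ∑' j : ℤ, μ ^ (k - j).natAbs * 0)) := by
    refine Tendsto.const_mul _ ?_
    refine tendsto_tsum_of_dominated_convergence
      (bound := fun j : ℤ => μ ^ (k - j).natAbs * b)
      ((summable_pow_natAbs_sub h.rate_nonneg h.rate_lt_one k).mul_right b) ?_ ?_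
    · intro j
      have := (hlim j).norm
      rw [norm_zero] at this
      exact this.const_mul _
    · filter_upwards [hg] with y hy j
      rw [norm_mul, norm_norm, Real.norm_of_nonneg (pow_nonneg h.rate_nonneg _)]
      exact mul_le_mul_of_nonneg_left (hy j) (pow_nonneg h.rate_nonneg _)
  simp only [mul_zero, tsum_zero] at h1
  refine squeeze_zero_norm' ?_ h1
  filter_upwards [hw, hg, heq] with y hy1 hy2 hy3
  exact h.norm_le_tsum _ _ hy1 ⟨b, hy2⟩ hy3 k

/-- Only the values of `g` near `k` matter for `w k`, up to a small error. -/
theorem norm_le_of_window (h : IsDichotomous A C μ) {N : ℕ} {w g : ℤ → E} {b b' : ℝ}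
    (hb : 0 ≤ b)
    (hw : ∃ b, ∀ k, ‖w k‖ ≤ b) (k : ℤ) (hg : ∀ j, (k - j).natAbs ≤ N → ‖g j‖ ≤ b)
    (hg' : ∀ j, ‖g j‖ ≤ b') (heq : ∀ k, w (k + 1) = A k (w k) + g k) :
    ‖w k‖ ≤ C * (∑' i : ℤ, μ ^ i.natAbs) * b +
      C * (∑' i : ℤ, μ ^ i.natAbs * (if N < i.natAbs then (1 : ℝ) else 0)) * b' := by
  refine (h.norm_le_tsum w g hw ⟨b', hg'⟩ heq k).trans ?_
  rw [mul_assoc, mul_assoc, ← mul_add]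
  refine mul_le_mul_of_nonneg_left ?_ h.const_nonneg
  have e2 : ∑' i : ℤ, μ ^ i.natAbs * (if N < i.natAbs then (1 : ℝ) else 0) =
      ∑' j : ℤ, μ ^ (k - j).natAbs * (if N < (k - j).natAbs then (1 : ℝ) else 0) :=
    ((Equiv.subLeft k).tsum_eq
      (fun i : ℤ => μ ^ i.natAbs * (if N < i.natAbs then (1 : ℝ) else 0))).symm
  have s2 : Summable fun j : ℤ =>
      μ ^ (k - j).natAbs * (if N < (k - j).natAbs then (1 : ℝ) else 0) :=
    summable_pow_natAbs_mul (b := 1) h.rate_nonneg h.rate_lt_one k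
      (fun j => by split_ifs <;> simp) (fun j => by split_ifs <;> simp)
  rw [e2, ← tsum_pow_natAbs_sub μ k, ← tsum_mul_right, ← tsum_mul_right,
    ← Summable.tsum_add ((summable_pow_natAbs_sub h.rate_nonneg h.rate_lt_one k).mul_right b)
      (s2.mul_right b')]
  refine Summable.tsum_le_tsum (fun j => ?_)
    (summable_pow_natAbs_mul h.rate_nonneg h.rate_lt_one k (fun _ => norm_nonneg _) hg')
    (((summable_pow_natAbs_sub h.rate_nonneg h.rate_lt_one k).mul_right b).add
      (s2.mul_right b'))
  have hp : 0 ≤ μ ^ (k - j).natAbs := pow_nonneg h.rate_nonneg _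
  split_ifs with hj
  · have := mul_le_mul_of_nonneg_left (hg' j) hp
    have := mul_nonneg hp hb
    linarith
  · have := mul_le_mul_of_nonneg_left (hg j (not_lt.1 hj)) hp
    linarith

/-- Derivatives in the parameter are operator-valued sequences. Their equation is solved vector by
vector; uniqueness of bounded solutions makes the result linear in the vector, and the Green
estimate makes it continuous with the same constants. -/
theorem compL (h : IsDichotomous A C μ) (X : Type*) [NormedAddCommGroup X] [NormedSpace ℝ X] :
    IsDichotomous (fun k => ContinuousLinearMap.compL ℝ X E E (A k)) C μ where
  const_nonneg := h.const_nonneg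
  rate_nonneg := h.rate_nonneg
  rate_lt_one := h.rate_lt_one
  norm_le_tsum := by
    rintro V G ⟨b, hb⟩ ⟨b', hb'⟩ heq k
    have hs : Summable fun j => μ ^ (k - j).natAbs * ‖G j‖ :=
      summable_pow_natAbs_mul h.rate_nonneg h.rate_lt_one k (fun _ => norm_nonneg _) hb'
    refine ContinuousLinearMap.opNorm_le_bound _ (mul_nonneg h.const_nonneg
      (tsum_nonneg fun j => mul_nonneg (pow_nonneg h.rate_nonneg _) (norm_nonneg _))) fun v => ?_
    have hG' : ∀ j, ‖G j v‖ ≤ b' * ‖v‖ := fun j => (G j).le_of_opNorm_le (hb' j) v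
    refine (h.norm_le_tsum (fun k => V k v) (fun k => G k v)
      ⟨b * ‖v‖, fun j => (V j).le_of_opNorm_le (hb j) v⟩ ⟨b' * ‖v‖, hG'⟩ ?_ k).trans ?_
    · intro k
      have := congrArg (fun L => L v) (heq k)
      simpa using this
    · rw [mul_assoc, ← tsum_mul_right]
      refine mul_le_mul_of_nonneg_left ?_ h.const_nonneg
      refine Summable.tsum_le_tsum (fun j => ?_)
        (summable_pow_natAbs_mul h.rate_nonneg h.rate_lt_one k (fun _ => norm_nonneg _) hG')
        (hs.mul_right _)
      rw [mul_assoc]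
      exact mul_le_mul_of_nonneg_left ((G j).le_opNorm v) (pow_nonneg h.rate_nonneg _)
  exists_solution := by
    rintro G ⟨b, hb⟩
    have hG : ∀ v, ∀ j, ‖G j v‖ ≤ b * ‖v‖ := fun v j => (G j).le_of_opNorm_le (hb j) v
    choose W hWb hW using fun v : X => h.exists_solution (fun k => G k v) ⟨_, hG v⟩
    have hadd : ∀ u v k, W (u + v) k = W u k + W v k := by
      intro u v k
      obtain ⟨b1, h1⟩ := hWb (u + v)
      obtain ⟨b2, h2⟩ := hWb u
      obtain ⟨b3, h3⟩ := hWb v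
      have := h.eq_zero (w := fun k => W (u + v) k - (W u k + W v k))
        ⟨b1 + (b2 + b3), fun k => (norm_sub_le _ _).trans
          (add_le_add (h1 k) ((norm_add_le _ _).trans (add_le_add (h2 k) (h3 k))))⟩
        (fun k => by rw [hW, hW, hW]; simp only [map_add, map_sub]; abel) k
      exact sub_eq_zero.1 this
    have hsmul : ∀ (c : ℝ) v k, W (c • v) k = c • W v k := by
      intro c v k
      obtain ⟨b1, h1⟩ := hWb (c • v)
      obtain ⟨b2, h2⟩ := hWb v
      have := h.eq_zero (w := fun k => W (c • v) k - c • W v k)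
        ⟨b1 + ‖c‖ * b2, fun k => (norm_sub_le _ _).trans
          (add_le_add (h1 k) ((norm_smul_le _ _).trans
            (mul_le_mul_of_nonneg_left (h2 k) (norm_nonneg _))))⟩
        (fun k => by rw [hW, hW]; simp only [map_smul, map_sub, smul_add]; abel) k
      exact sub_eq_zero.1 this
    have hbd : ∀ v k, ‖W v k‖ ≤ C * (∑' i : ℤ, μ ^ i.natAbs) * b * ‖v‖ := fun v k => by
      rw [mul_assoc]; exact h.norm_le (hWb v) (hG v) (hW v) k
    let V : ℤ → X →L[ℝ] E := fun k => LinearMap.mkContinuous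
      { toFun := fun v => W v k
        map_add' := fun u v => hadd u v k
        map_smul' := fun c v => hsmul c v k } _ (fun v => hbd v k)
    refine ⟨V, ⟨|C * (∑' i : ℤ, μ ^ i.natAbs) * b|, fun k => ?_⟩, fun k => ?_⟩
    · refine ContinuousLinearMap.opNorm_le_bound _ (abs_nonneg _) fun v => ?_
      exact (hbd v k).trans (mul_le_mul_of_nonneg_right (le_abs_self _) (norm_nonneg _))
    · ext v
      exact hW v k

end IsDichotomous

end Dichotomy

/-! ### Dichotomy from a uniformly exponential invariant splitting. -/

section Splitting

variable {E : Type*} [NormedAddCommGroup E] [NormedSpace ℝ E]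

/-- `A (k+N-1) ⋯ A k`. -/
def transition (A : ℤ → E →L[ℝ] E) (k : ℤ) : ℕ → E →L[ℝ] E
  | 0 => ContinuousLinearMap.id ℝ E
  | N + 1 => (A (k + N)).comp (transition A k N)

theorem transition_succ_apply (A : ℤ → E →L[ℝ] E) (k : ℤ) (N : ℕ) (v : E) :
    transition A k (N + 1) v = A (k + N) (transition A k N v) := rfl

theorem transition_succ_apply' (A : ℤ → E →L[ℝ] E) (k : ℤ) (N : ℕ) (v : E) :
    transition A k (N + 1) v = transition A (k + 1) N (A k v) := by
  induction N generalizing v with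
  | zero => simp [transition]
  | succ N ih =>
    rw [transition_succ_apply, ih, transition_succ_apply]
    congr 2
    push_cast
    ring

/-- Partial unfolding of a solution of the difference equation. -/
theorem eq_transition_add_sum {A : ℤ → E →L[ℝ] E} {s p : ℤ → E}
    (heq : ∀ k, s (k + 1) = A k (s k) + p (k + 1)) (k : ℤ) (N : ℕ) :
    s k = transition A (k - N) N (s (k - N)) +
      ∑ i ∈ Finset.range N, transition A (k - i) i (p (k - i)) := by
  induction N with
  | zero => simp [transition]
  | succ N ih =>
    rw [ih, Finset.sum_range_succ, transition_succ_apply']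
    have e : k - ((N + 1 : ℕ) : ℤ) + 1 = k - N := by push_cast; ring
    have := heq (k - ((N + 1 : ℕ) : ℤ))
    rw [e] at this ⊢
    rw [this, map_add]
    abel

/-- Unfolding `N` steps into the past leaves an initial term at most `C μ^N b`, which vanishes in
the limit, and forcing terms weighted by `C μ^i`. The forcing is indexed by its arrival time `k +
1`, so that it lies in the fibre where it acts. -/
theorem norm_le_tsum_of_contracting {A : ℤ → E →L[ℝ] E} {S : ℤ → Submodule ℝ E} {C μ : ℝ}
    (hC : 0 ≤ C) (h0 : 0 ≤ μ) (h1 : μ < 1)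
    (hS : ∀ k, ∀ v ∈ S k, ∀ N : ℕ, ‖transition A k N v‖ ≤ C * μ ^ N * ‖v‖)
    {s p : ℤ → E} (hs : ∀ k, s k ∈ S k) (hp : ∀ k, p k ∈ S k) (hsb : ∃ b, ∀ k, ‖s k‖ ≤ b)
    (hpb : ∃ b, ∀ k, ‖p k‖ ≤ b) (heq : ∀ k, s (k + 1) = A k (s k) + p (k + 1)) (k : ℤ) :
    ‖s k‖ ≤ C * ∑' j : ℤ, μ ^ (k - j).natAbs * ‖p j‖ := by
  obtain ⟨b, hb⟩ := hsb
  obtain ⟨b', hb'⟩ := hpb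
  have hsum := summable_pow_natAbs_mul h0 h1 k (fun j => norm_nonneg (p j)) hb'
  have hN : ∀ N : ℕ, ‖s k‖ ≤ C * μ ^ N * b + C * ∑' j : ℤ, μ ^ (k - j).natAbs * ‖p j‖ := by
    intro N
    rw [eq_transition_add_sum heq k N]
    refine (norm_add_le _ _).trans (add_le_add ?_ ?_)
    · exact (hS _ _ (hs _) N).trans
        (mul_le_mul_of_nonneg_left (hb _) (mul_nonneg hC (pow_nonneg h0 _)))
    · refine (norm_sum_le _ _).trans ?_
      have h2 : ∑ i ∈ Finset.range N, ‖transition A (k - i) i (p (k - i))‖ ≤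
          C * ∑ i ∈ Finset.range N, μ ^ i * ‖p (k - i)‖ := by
        rw [Finset.mul_sum]
        refine Finset.sum_le_sum fun i _ => ?_
        rw [← mul_assoc]
        exact hS _ _ (hp _) i
      refine h2.trans (mul_le_mul_of_nonneg_left ?_ hC)
      have hinj : Function.Injective (fun i : ℕ => k - (i : ℤ)) := fun i j hij => by
        simpa using hij
      have h3 := hsum.sum_le_tsum ((Finset.range N).map ⟨_, hinj⟩)
        (fun j _ => mul_nonneg (pow_nonneg h0 _) (norm_nonneg _))
      simpa using h3
  have hlim : Tendsto (fun N : ℕ => C * μ ^ N * b + C * ∑' j : ℤ, μ ^ (k - j).natAbs * ‖p j‖)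
      atTop (𝓝 (C * 0 * b + C * ∑' j : ℤ, μ ^ (k - j).natAbs * ‖p j‖)) :=
    (((tendsto_pow_atTop_nhds_zero_of_lt_one h0 h1).const_mul C).mul_const b).add_const _
  simpa using ge_of_tendsto' hlim hN

theorem exists_solution_of_contracting [CompleteSpace E] {A : ℤ → E →L[ℝ] E}
    {S : ℤ → Submodule ℝ E} {C μ : ℝ} (hC : 0 ≤ C) (h0 : 0 ≤ μ) (h1 : μ < 1)
    (hS : ∀ k, ∀ v ∈ S k, ∀ N : ℕ, ‖transition A k N v‖ ≤ C * μ ^ N * ‖v‖)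
    {p : ℤ → E} (hp : ∀ k, p k ∈ S k) (hpb : ∃ b, ∀ k, ‖p k‖ ≤ b) :
    ∃ s : ℤ → E, (∃ b, ∀ k, ‖s k‖ ≤ b) ∧ ∀ k, s (k + 1) = A k (s k) + p (k + 1) := by
  obtain ⟨b, hb⟩ := hpb
  have hle : ∀ (k : ℤ) (i : ℕ), ‖transition A (k - i) i (p (k - i))‖ ≤ μ ^ i * (C * b) := by
    intro k i
    refine (hS _ _ (hp _) i).trans ?_
    have := mul_le_mul_of_nonneg_left (hb (k - i)) (mul_nonneg hC (pow_nonneg h0 i))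
    linarith
  have hg : Summable fun i : ℕ => μ ^ i * (C * b) :=
    (summable_geometric_of_lt_one h0 h1).mul_right _
  have hsum : ∀ k : ℤ, Summable fun i : ℕ => transition A (k - i) i (p (k - i)) := fun k =>
    Summable.of_norm_bounded hg (hle k)
  refine ⟨fun k => ∑' i : ℕ, transition A (k - i) i (p (k - i)),
    ⟨∑' i : ℕ, μ ^ i * (C * b), fun k => tsum_of_norm_bounded hg.hasSum (hle k)⟩, fun k => ?_⟩
  dsimp only
  rw [(hsum (k + 1)).tsum_eq_zero_add, (A k).map_tsum (hsum k), add_comm]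
  congr 1
  · refine tsum_congr fun i => ?_
    rw [transition_succ_apply]
    have e : k + 1 - ((i + 1 : ℕ) : ℤ) = k - i := by push_cast; ring
    rw [e, sub_add_cancel]
  · simp [transition]

/-- The sequence of inverses run backwards in time. -/
noncomputable def timeReversal (A : ℤ → E →L[ℝ] E) (j : ℤ) : E →L[ℝ] E := (A (-j - 1)).inverse

/-- Reversed time `j` stands for the fibre `-j`, and the step at `j` goes to the fibre `-j - 1`;
starting at `-(k + N)` thus retraces the fibres from `k + N` down to `k`. -/
theorem transition_timeReversal_transition {A : ℤ → E →L[ℝ] E} (hA : ∀ k, (A k).IsInvertible)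
    (k : ℤ) (N : ℕ) (v : E) :
    transition (timeReversal A) (-(k + N)) N (transition A k N v) = v := by
  induction N with
  | zero => simp [transition]
  | succ N ih =>
    rw [transition_succ_apply', transition_succ_apply]
    have e1 : -(k + ((N + 1 : ℕ) : ℤ)) + 1 = -(k + N) := by push_cast; ring
    have e2 : -(-(k + ((N + 1 : ℕ) : ℤ))) - 1 = k + N := by push_cast; ring
    rw [e1, timeReversal, e2, (hA (k + N)).inverse_apply_self, ih]

/-- A uniformly exponential invariant splitting of a sequence of operators. -/
structure IsHyperbolicSplitting (A : ℤ → E →L[ℝ] E) (S U : ℤ → Submodule ℝ E)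
    (pS pU : ℤ → E →L[ℝ] E) (C μ : ℝ) : Prop where
  invertible : ∀ k, (A k).IsInvertible
  disjoint : ∀ k, Disjoint (S k) (U k)
  projS_mem : ∀ k v, pS k v ∈ S k
  projU_mem : ∀ k v, pU k v ∈ U k
  proj_add : ∀ k v, pS k v + pU k v = v
  stable : ∀ k, ∀ v ∈ S k, ∀ N : ℕ, ‖transition A k N v‖ ≤ C * μ ^ N * ‖v‖
  unstable : ∀ k, ∀ v ∈ U k, ∀ N : ℕ,
    ‖transition (timeReversal A) (-k) N v‖ ≤ C * μ ^ N * ‖v‖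
  mapS : ∀ k, ∀ v ∈ S k, A k v ∈ S (k + 1)
  mapU : ∀ k, ∀ v ∈ U k, A k v ∈ U (k + 1)

namespace IsHyperbolicSplitting

variable {A : ℤ → E →L[ℝ] E} {S U : ℤ → Submodule ℝ E} {pS pU : ℤ → E →L[ℝ] E} {C μ : ℝ}

/-- The defect in the stable component equals minus the defect in the unstable one, so it lies in
both spaces and vanishes. -/
theorem proj_map (h : IsHyperbolicSplitting A S U pS pU C μ) (k : ℤ) (v : E) :
    pS (k + 1) (A k v) = A k (pS k v) ∧ pU (k + 1) (A k v) = A k (pU k v) := by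
  have e : pS (k + 1) (A k v) - A k (pS k v) = A k (pU k v) - pU (k + 1) (A k v) := by
    have h1 := h.proj_add (k + 1) (A k v)
    have h2 := congrArg (A k) (h.proj_add k v)
    rw [map_add] at h2
    rw [sub_eq_sub_iff_add_eq_add, h1, add_comm, h2]
  have m1 := (S (k + 1)).sub_mem (h.projS_mem (k + 1) (A k v)) (h.mapS k _ (h.projS_mem k v))
  have m2 := (U (k + 1)).sub_mem (h.mapU k _ (h.projU_mem k v)) (h.projU_mem (k + 1) (A k v))
  rw [← e] at m2
  have z := Submodule.disjoint_def.1 (h.disjoint (k + 1)) _ m1 m2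
  exact ⟨sub_eq_zero.1 z, (sub_eq_zero.1 (e ▸ z)).symm⟩

theorem transition_mem (h : IsHyperbolicSplitting A S U pS pU C μ) (k : ℤ) (N : ℕ) {v : E}
    (hv : v ∈ U k) : transition A k N v ∈ U (k + N) := by
  induction N with
  | zero => simpa [transition] using hv
  | succ N ih =>
    have := h.mapU _ _ ih
    rw [transition_succ_apply]
    push_cast
    rwa [← add_assoc]

theorem norm_transition_le {b : ℝ} (hb : ∀ k, ‖A k‖ ≤ b) (k : ℤ) (N : ℕ) (v : E) :
    ‖transition A k N v‖ ≤ b ^ N * ‖v‖ := by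
  have hb0 : 0 ≤ b := (norm_nonneg _).trans (hb 0)
  induction N with
  | zero => simp [transition]
  | succ N ih =>
    rw [transition_succ_apply, pow_succ']
    refine ((A _).le_of_opNorm_le (hb _) _).trans ?_
    rw [mul_assoc]
    exact mul_le_mul_of_nonneg_left ih hb0

/-- The angle between the stable and unstable spaces is bounded below. -/
theorem norm_proj_le (h : IsHyperbolicSplitting A S U pS pU C μ)
    {b : ℝ} (hb : ∀ k, ‖A k‖ ≤ b) {N : ℕ} (hN : C * μ ^ N ≤ 1 / 2) (k : ℤ) (v : E) :
    ‖pS k v‖ ≤ (b ^ N + 2) * ‖v‖ ∧ ‖pU k v‖ ≤ (b ^ N + 1) * ‖v‖ := by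
  have hb0 : 0 ≤ b := (norm_nonneg _).trans (hb 0)
  have hadd := h.proj_add k v
  have hs : ‖pS k v‖ ≤ ‖v‖ + ‖pU k v‖ := by
    rw [eq_sub_of_add_eq hadd]; exact norm_sub_le _ _
  -- After `N` steps the stable part is at most halved and the unstable part at least doubled, so
  -- the two cannot nearly cancel in the image of `v`, whose norm is at most `b ^ N * ‖v‖`.
  have h1 := h.stable k _ (h.projS_mem k v) N
  have h2 := h.unstable (k + N) _ (h.transition_mem k N (h.projU_mem k v)) N
  rw [transition_timeReversal_transition h.invertible] at h2
  have h3 := norm_transition_le hb k N v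
  have h4 : ‖transition A k N (pU k v)‖ ≤ b ^ N * ‖v‖ + 1 / 2 * (‖v‖ + ‖pU k v‖) := by
    rw [eq_sub_of_add_eq' hadd, map_sub]
    refine (norm_sub_le _ _).trans (add_le_add h3 (h1.trans ?_))
    rw [← eq_sub_of_add_eq' hadd]
    exact mul_le_mul hN hs (norm_nonneg _) (by norm_num)
  have h5 : ‖pU k v‖ ≤ 1 / 2 * ‖transition A k N (pU k v)‖ :=
    h2.trans (mul_le_mul_of_nonneg_right hN (norm_nonneg _))
  have h6 : 0 ≤ b ^ N * ‖v‖ := mul_nonneg (pow_nonneg hb0 _) (norm_nonneg _)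
  have h7 := norm_nonneg v
  have h8 : ‖pU k v‖ ≤ (b ^ N + 1) * ‖v‖ := by linarith
  exact ⟨by linarith, h8⟩

/-- The stable component is summed from the past, the unstable one from the future through the
reversed sequence. In the constant, `b` bounds the projections, `μ⁻¹` pays for the shift from `g k`
to arrival time `k + 1`, and `1 + 2 * C` is `C` for the stable part plus `C + 1` for the unstable
part. -/
theorem isDichotomous [CompleteSpace E] (h : IsHyperbolicSplitting A S U pS pU C μ)
    (h0 : 0 < μ) (h1 : μ < 1) (hC : 0 ≤ C) {b : ℝ} (hb : ∀ k, ‖pS k‖ ≤ b ∧ ‖pU k‖ ≤ b) :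
    IsDichotomous A ((1 + 2 * C) * (b * μ⁻¹)) μ := by
  have hb0 : 0 ≤ b := (norm_nonneg _).trans (hb 0).1
  refine ⟨by positivity, h0.le, h1, ?_, ?_⟩
  · rintro w g ⟨b1, hw⟩ ⟨b2, hg⟩ heq k
    have hb2 : 0 ≤ b2 := (norm_nonneg _).trans (hg 0)
    have key : ∀ (q : ℤ → E →L[ℝ] E), (∀ k, ‖q k‖ ≤ b) →
        (∃ b', ∀ k, ‖q k (g (k - 1))‖ ≤ b') ∧ ∑' j : ℤ, μ ^ (k - j).natAbs * ‖q j (g (j - 1))‖ ≤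
          b * μ⁻¹ * ∑' j : ℤ, μ ^ (k - j).natAbs * ‖g j‖ := by
      intro q hq
      have hbd : ∀ k, ‖q k (g (k - 1))‖ ≤ b * ‖g (k - 1)‖ := fun k =>
        (q k).le_of_opNorm_le (hq k) _
      have hbd' : ∀ k, ‖q k (g (k - 1))‖ ≤ b * b2 := fun k =>
        (hbd k).trans (mul_le_mul_of_nonneg_left (hg _) hb0)
      refine ⟨⟨b * b2, hbd'⟩, ?_⟩
      have hs := summable_pow_natAbs_mul h0.le h1 k (fun _ => norm_nonneg _) hg
      rw [← tsum_mul_left, ← (Equiv.subRight (1 : ℤ)).tsum_eq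
        (fun j => b * μ⁻¹ * (μ ^ (k - j).natAbs * ‖g j‖))]
      refine Summable.tsum_le_tsum (fun j => ?_)
        (summable_pow_natAbs_mul h0.le h1 k (fun _ => norm_nonneg _) hbd')
        ((hs.mul_left _).comp_injective (Equiv.subRight (1 : ℤ)).injective)
      simp only [Equiv.subRight_apply]
      have hpow : μ ^ (k - j).natAbs ≤ μ⁻¹ * μ ^ (k - (j - 1)).natAbs := by
        rw [inv_mul_eq_div, le_div_iff₀ h0, ← pow_succ]
        exact pow_le_pow_of_le_one h0.le h1.le (by omega)
      calc μ ^ (k - j).natAbs * ‖q j (g (j - 1))‖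
          ≤ (μ⁻¹ * μ ^ (k - (j - 1)).natAbs) * (b * ‖g (j - 1)‖) :=
            mul_le_mul hpow (hbd j) (norm_nonneg _) (by positivity)
        _ = _ := by ring
    obtain ⟨bS, kS⟩ := key pS fun k => (hb k).1
    obtain ⟨⟨bU', hbU'⟩, kU⟩ := key pU fun k => (hb k).2
    have hS := norm_le_tsum_of_contracting hC h0.le h1 h.stable
      (s := fun k => pS k (w k)) (p := fun k => pS k (g (k - 1)))
      (fun k => h.projS_mem _ _) (fun k => h.projS_mem _ _)
      ⟨b * b1, fun k => ((pS k).le_of_opNorm_le (hb k).1 _).trans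
        (mul_le_mul_of_nonneg_left (hw k) hb0)⟩ bS
      (fun k => by simp only [add_sub_cancel_right]; rw [heq, map_add, (h.proj_map k _).1]) k
    set p : ℤ → E := fun k => pU k (g (k - 1)) with hp
    set u : ℤ → E := fun k => pU k (w k) with hu
    have hueq : ∀ k, u (k + 1) = A k (u k) + p (k + 1) := fun k => by
      simp only [hu, hp, add_sub_cancel_right]; rw [heq, map_add, (h.proj_map k _).2]
    have hub : ∀ k, ‖u k‖ ≤ b * b1 := fun k => ((pU k).le_of_opNorm_le (hb k).2 _).trans
        (mul_le_mul_of_nonneg_left (hw k) hb0)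
    -- Since `u k - p k` is the image of `u (k - 1)`, it is `u - p`, not `u`, that solves a reversed
    -- equation with forcing at arrival time. Returning to `u` costs the extra `‖p k‖`.
    have hU := norm_le_tsum_of_contracting (A := timeReversal A) (S := fun k => U (-k))
      hC h0.le h1 (fun k v hv N => by simpa using h.unstable (-k) v hv N)
      (s := fun k => u (-k) - p (-k)) (p := fun k => -p (-k))
      (fun k => (U (-k)).sub_mem (h.projU_mem _ _) (h.projU_mem _ _))
      (fun k => (U (-k)).neg_mem (h.projU_mem _ _))
      ⟨b * b1 + bU', fun k => (norm_sub_le _ _).trans (add_le_add (hub _) (hbU' _))⟩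
      ⟨bU', fun k => by rw [norm_neg]; exact hbU' _⟩
      (fun k => by
        have := hueq (-k - 1)
        rw [sub_add_cancel] at this
        simp only [timeReversal]
        rw [this, add_sub_cancel_right, (h.invertible _).inverse_apply_self,
          show -(k + 1) = -k - 1 by ring, sub_eq_add_neg]) (-k)
    have e : ∑' j : ℤ, μ ^ (-k - j).natAbs * ‖-p (-j)‖ =
        ∑' j : ℤ, μ ^ (k - j).natAbs * ‖p j‖ := by
      rw [← (Equiv.neg ℤ).tsum_eq (fun j : ℤ => μ ^ (k - j).natAbs * ‖p j‖)]
      refine tsum_congr fun j => ?_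
      rw [norm_neg, Equiv.neg_apply, show (-k - j).natAbs = (k - -j).natAbs by omega]
    rw [e] at hU
    simp only [neg_neg] at hU
    have hpk : ‖p k‖ ≤ ∑' j : ℤ, μ ^ (k - j).natAbs * ‖p j‖ := by
      have := (summable_pow_natAbs_mul h0.le h1 k (fun _ => norm_nonneg _) hbU').le_tsum k
        (fun j _ => mul_nonneg (pow_nonneg h0.le _) (norm_nonneg _))
      simpa using this
    have hwk : ‖w k‖ ≤ ‖pS k (w k)‖ + (‖u k - p k‖ + ‖p k‖) := by
      have hn : ‖u k‖ ≤ ‖u k - p k‖ + ‖p k‖ := by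
        simpa using norm_add_le (u k - p k) (p k)
      calc ‖w k‖ = ‖pS k (w k) + u k‖ := by rw [hu, h.proj_add]
        _ ≤ _ := (norm_add_le _ _).trans (by gcongr)
    have f1 := mul_le_mul_of_nonneg_left kS hC
    have f2 := mul_le_mul_of_nonneg_left kU hC
    rw [show (1 + 2 * C) * (b * μ⁻¹) * ∑' j : ℤ, μ ^ (k - j).natAbs * ‖g j‖ =
      C * (b * μ⁻¹ * ∑' j : ℤ, μ ^ (k - j).natAbs * ‖g j‖) +
      (C * (b * μ⁻¹ * ∑' j : ℤ, μ ^ (k - j).natAbs * ‖g j‖) +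
        b * μ⁻¹ * ∑' j : ℤ, μ ^ (k - j).natAbs * ‖g j‖) by ring]
    linarith
  · rintro g ⟨b2, hg⟩
    have hbd : ∀ (q : ℤ → E →L[ℝ] E), (∀ k, ‖q k‖ ≤ b) → ∀ k, ‖q k (g (k - 1))‖ ≤ b * b2 :=
      fun q hq k => ((q k).le_of_opNorm_le (hq k) _).trans
        (mul_le_mul_of_nonneg_left (hg _) hb0)
    obtain ⟨s, ⟨bs, hs⟩, hseq⟩ := exists_solution_of_contracting hC h0.le h1 h.stable
      (p := fun k => pS k (g (k - 1))) (fun k => h.projS_mem _ _)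
      ⟨_, hbd pS fun k => (hb k).1⟩
    have hpU := hbd pU fun k => (hb k).2
    obtain ⟨v, ⟨bv, hv⟩, hveq⟩ := exists_solution_of_contracting (A := timeReversal A)
      (S := fun k => U (-k)) hC h0.le h1
      (fun k v hv N => by simpa using h.unstable (-k) v hv N)
      (p := fun k => -pU (-k) (g (-k - 1))) (fun k => (U (-k)).neg_mem (h.projU_mem _ _))
      ⟨b * b2, fun k => by rw [norm_neg]; exact hpU _⟩
    refine ⟨fun k => s k + (v (-k) + pU k (g (k - 1))), ⟨bs + (bv + b * b2), fun k =>
      (norm_add_le _ _).trans (add_le_add (hs k) ((norm_add_le _ _).trans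
        (add_le_add (hv _) (hpU k))))⟩, fun k => ?_⟩
    have e1 := hseq k
    have e2 := hveq (-(k + 1))
    rw [show -(k + 1) + 1 = -k by ring] at e2
    simp only [timeReversal, neg_neg, show k + 1 - 1 = k by ring] at e1 e2
    simp only [show k + 1 - 1 = k by ring]
    rw [e1, e2, neg_add_cancel_right, map_add, (h.invertible k).self_apply_inverse]
    have := h.proj_add (k + 1) (g k)
    trans (A k) (s k) + v (-(k + 1)) + (pS (k + 1) (g k) + pU (k + 1) (g k))
    · abel
    · rw [this]

end IsHyperbolicSplitting

/-- The dichotomy constants depend only on the constants of the splitting. -/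
theorem exists_isDichotomous_of_splitting [CompleteSpace E] {C μ b : ℝ} (hC : 0 ≤ C)
    (h0 : 0 < μ) (h1 : μ < 1) :
    ∃ C' : ℝ, ∀ (A : ℤ → E →L[ℝ] E) (S U : ℤ → Submodule ℝ E) (pS pU : ℤ → E →L[ℝ] E),
      IsHyperbolicSplitting A S U pS pU C μ → (∀ k, ‖A k‖ ≤ b) → IsDichotomous A C' μ := by
  have hlim : Tendsto (fun N : ℕ => C * μ ^ N) atTop (𝓝 (C * 0)) :=
    (tendsto_pow_atTop_nhds_zero_of_lt_one h0.le h1).const_mul C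
  rw [mul_zero] at hlim
  obtain ⟨N, hN⟩ := (hlim.eventually (Iic_mem_nhds (show (0 : ℝ) < 1 / 2 by norm_num))).exists
  refine ⟨_, fun A S U pS pU h hb => h.isDichotomous h0 h1 hC (b := b ^ N + 2) fun k => ?_⟩
  have hb0 : 0 ≤ b := (norm_nonneg _).trans (hb 0)
  have := h.norm_proj_le hb hN k
  refine ⟨ContinuousLinearMap.opNorm_le_bound _ (by positivity) fun v => (this v).1,
    ContinuousLinearMap.opNorm_le_bound _ (by positivity) fun v => (this v).2.trans ?_⟩
  gcongr
  norm_num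

end Splitting

/-! ### Families of maps with uniformly bounded derivatives. -/

section UniformlyCk

variable {ι : Type*} {X E F G : Type*} [NormedAddCommGroup X] [NormedSpace ℝ X]
  [NormedAddCommGroup E] [NormedSpace ℝ E] [NormedAddCommGroup F] [NormedSpace ℝ F]
  [NormedAddCommGroup G] [NormedSpace ℝ G]

/-- A family of `C^s` maps whose derivatives up to order `s` have a common bound. -/
def IsUniformlyCk (s : ℕ) (f : ι → X → E) : Prop :=
  (∀ i, ContDiff ℝ s (f i)) ∧ ∃ B : ℝ, ∀ i, ∀ k ≤ s, ∀ x, ‖iteratedFDeriv ℝ k (f i) x‖ ≤ B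

/-- A family of maps that are `C^s` on `W`, with a common bound there for the derivatives. -/
def IsUniformlyCkOn (s : ℕ) (W : Set X) (f : ι → X → E) : Prop :=
  (∀ i, ContDiffOn ℝ s (f i) W) ∧
    ∃ B : ℝ, ∀ i, ∀ k ≤ s, ∀ x ∈ W, ‖iteratedFDeriv ℝ k (f i) x‖ ≤ B

theorem isUniformlyCk_zero {f : ι → X → E} :
    IsUniformlyCk 0 f ↔ (∀ i, Continuous (f i)) ∧ ∃ B : ℝ, ∀ i x, ‖f i x‖ ≤ B := by
  simp [IsUniformlyCk]

namespace IsUniformlyCk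

variable {s : ℕ} {f : ι → X → E} {g : ι → X → F}

theorem bounded (h : IsUniformlyCk s f) : ∃ B : ℝ, ∀ i x, ‖f i x‖ ≤ B := by
  obtain ⟨-, B, hB⟩ := h
  exact ⟨B, fun i x => by simpa using hB i 0 (Nat.zero_le _) x⟩

theorem of_le {t : ℕ} (h : IsUniformlyCk s f) (hts : t ≤ s) : IsUniformlyCk t f :=
  ⟨fun i => (h.1 i).of_le (by exact_mod_cast hts), h.2.imp fun B hB i k hk => hB i k (hk.trans hts)⟩

theorem succ_iff : IsUniformlyCk (s + 1) f ↔ (∀ i, Differentiable ℝ (f i)) ∧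
    (∃ B : ℝ, ∀ i x, ‖f i x‖ ≤ B) ∧ IsUniformlyCk s (fun i => fderiv ℝ (f i)) := by
  constructor
  · intro h
    refine ⟨fun i => (h.1 i).differentiable (by simp), h.bounded, fun i => ?_, ?_⟩
    · exact (h.1 i).fderiv_right (m := s) (by simp)
    · obtain ⟨-, B, hB⟩ := h
      refine ⟨B, fun i k hk x => ?_⟩
      rw [norm_iteratedFDeriv_fderiv]
      exact hB i (k + 1) (by omega) x
  · rintro ⟨h1, ⟨B, hB⟩, h2, B', hB'⟩
    refine ⟨fun i => ?_, max B B', fun i k hk x => ?_⟩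
    · push_cast
      exact contDiff_succ_iff_fderiv.2 ⟨h1 i, by simp, h2 i⟩
    · cases k with
      | zero => simpa using Or.inl (hB i x)
      | succ k =>
        rw [← norm_iteratedFDeriv_fderiv]
        exact (hB' i k (by omega) x).trans (le_max_right _ _)

theorem lipschitz (h : IsUniformlyCk (s + 1) f) :
    ∃ L : ℝ, ∀ i x y, ‖f i y - f i x‖ ≤ L * ‖y - x‖ := by
  obtain ⟨hd, -, hf⟩ := succ_iff.1 h
  obtain ⟨B, hB⟩ := hf.bounded
  exact ⟨B, fun i x y => convex_univ.norm_image_sub_le_of_norm_fderiv_le (𝕜 := ℝ)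
    (fun z _ => hd i z) (fun z _ => hB i z) (mem_univ x) (mem_univ y)⟩

theorem bilinear (hf : IsUniformlyCk s f) (hg : IsUniformlyCk s g) (L : E →L[ℝ] F →L[ℝ] G) :
    IsUniformlyCk s (fun i x => L (f i x) (g i x)) := by
  obtain ⟨hf, B, hB⟩ := hf
  obtain ⟨hg, B', hB'⟩ := hg
  refine ⟨fun i => L.isBoundedBilinearMap.contDiff.comp ((hf i).prodMk (hg i)),
    ‖L‖ * ∑ k ∈ Finset.range (s + 1), ∑ j ∈ Finset.range (k + 1), (k.choose j : ℝ) * |B| * |B'|,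
    fun i k hk x => ?_⟩
  refine (L.norm_iteratedFDeriv_le_of_bilinear (hf i) (hg i) x (n := k)
    (by exact_mod_cast hk)).trans (mul_le_mul_of_nonneg_left ?_ (norm_nonneg L))
  refine le_trans ?_ (Finset.single_le_sum
    (f := fun k => ∑ j ∈ Finset.range (k + 1), (k.choose j : ℝ) * |B| * |B'|)
    (fun k _ => by positivity) (Finset.mem_range.2 (Nat.lt_succ_of_le hk)))
  refine Finset.sum_le_sum fun j hj => ?_
  have hj' := Finset.mem_range.1 hj
  gcongr
  · exact (hB i j (by omega) x).trans (le_abs_self _)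
  · exact (hB' i (k - j) (by omega) x).trans (le_abs_self _)

theorem clm_comp (hf : IsUniformlyCk s f) (L : E →L[ℝ] F) :
    IsUniformlyCk s (fun i x => L (f i x)) := by
  obtain ⟨hf, B, hB⟩ := hf
  refine ⟨fun i => L.contDiff.comp (hf i), ‖L‖ * B, fun i k hk x => ?_⟩
  have hc : ContDiffAt ℝ s (f i) x := (hf i).contDiffAt
  have := L.iteratedFDeriv_comp_left hc (i := k) (by exact_mod_cast hk)
  change ‖iteratedFDeriv ℝ k (L ∘ f i) x‖ ≤ _
  rw [this]
  exact (L.norm_compContinuousMultilinearMap_le _).trans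
    (mul_le_mul_of_nonneg_left (hB i k hk x) (norm_nonneg _))

theorem add {g : ι → X → E} (hf : IsUniformlyCk s f) (hg : IsUniformlyCk s g) :
    IsUniformlyCk s (fun i x => f i x + g i x) := by
  obtain ⟨hf, B, hB⟩ := hf
  obtain ⟨hg, B', hB'⟩ := hg
  refine ⟨fun i => (hf i).add (hg i), B + B', fun i k hk x => ?_⟩
  have := iteratedFDeriv_add_apply (x := x)
    ((hf i).contDiffAt.of_le (m := k) (by exact_mod_cast hk))
    ((hg i).contDiffAt.of_le (m := k) (by exact_mod_cast hk))
  change ‖iteratedFDeriv ℝ k (f i + g i) x‖ ≤ _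
  rw [this]
  exact (norm_add_le _ _).trans (add_le_add (hB i k hk x) (hB' i k hk x))

theorem const (s : ℕ) (v : E) : IsUniformlyCk s (fun (_ : ι) (_ : X) => v) := by
  refine ⟨fun _ => contDiff_const, ‖v‖, fun i k hk x => ?_⟩
  cases k with
  | zero => simp
  | succ k =>
    rw [iteratedFDeriv_const_of_ne (by simp)]
    simp

end IsUniformlyCk

namespace IsUniformlyCkOn

variable {s : ℕ} {W : Set X} {f : ι → X → E}

theorem fderiv_family (h : IsUniformlyCkOn (s + 1) W f) (hW : IsOpen W) :
    IsUniformlyCkOn s W (fun i => fderiv ℝ (f i)) := by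
  obtain ⟨hf, B, hB⟩ := h
  refine ⟨fun i => (hf i).fderiv_of_isOpen hW (by simp), B, fun i k hk x hx => ?_⟩
  rw [norm_iteratedFDeriv_fderiv]
  exact hB i (k + 1) (by omega) x hx

theorem of_le {t : ℕ} (h : IsUniformlyCkOn s W f) (hts : t ≤ s) : IsUniformlyCkOn t W f :=
  ⟨fun i => (h.1 i).of_le (by exact_mod_cast hts),
    h.2.imp fun B hB i k hk => hB i k (hk.trans hts)⟩

theorem norm_le (h : IsUniformlyCkOn s W f) : ∃ B : ℝ, ∀ i, ∀ x ∈ W, ‖f i x‖ ≤ B := by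
  obtain ⟨-, B, hB⟩ := h
  exact ⟨B, fun i x hx => by simpa using hB i 0 (Nat.zero_le _) x hx⟩

theorem differentiableAt (h : IsUniformlyCkOn (s + 1) W f) (hW : IsOpen W) (i : ι) {x : X}
    (hx : x ∈ W) : DifferentiableAt ℝ (f i) x :=
  ((h.1 i).differentiableOn (by simp) x hx).differentiableAt (hW.mem_nhds hx)

end IsUniformlyCkOn

end UniformlyCk

/-- Substituting a uniformly `C^s` family into a uniformly `C^s` family. -/
theorem IsUniformlyCkOn.comp_graph {ι : Type*} {X Y : Type} [NormedAddCommGroup X]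
    [NormedSpace ℝ X] [NormedAddCommGroup Y] [NormedSpace ℝ Y] {W : Set (Y × X)} (hW : IsOpen W)
    {K : ι → X → Y} (hKW : ∀ i x, (K i x, x) ∈ W) {s : ℕ} (hK : IsUniformlyCk s K) :
    ∀ {E : Type} [NormedAddCommGroup E] [NormedSpace ℝ E] {f : ι → Y × X → E},
      IsUniformlyCkOn s W f → IsUniformlyCk s (fun i x => f i (K i x, x)) := by
  induction s with
  | zero =>
    intro E _ _ f hf
    obtain ⟨hKc, -⟩ := isUniformlyCk_zero.1 hK
    obtain ⟨B, hB⟩ := hf.norm_le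
    refine isUniformlyCk_zero.2 ⟨fun i => ?_, B, fun i x => hB i _ (hKW i x)⟩
    exact (hf.1 i).continuousOn.comp_continuous ((hKc i).prodMk continuous_id) (hKW i)
  | succ s ih =>
    intro E _ _ f hf
    obtain ⟨hKd, -, hK'⟩ := IsUniformlyCk.succ_iff.1 hK
    have hder : ∀ i x, HasFDerivAt (fun x => f i (K i x, x))
        ((fderiv ℝ (f i) (K i x, x)).comp
          ((fderiv ℝ (K i) x).prod (ContinuousLinearMap.id ℝ X))) x := fun i x =>
      HasFDerivAt.comp (f := fun x => (K i x, x)) x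
        (hf.differentiableAt hW i (hKW i x)).hasFDerivAt
        ((hKd i x).hasFDerivAt.prodMk (hasFDerivAt_id x))
    obtain ⟨B, hB⟩ := hf.norm_le
    refine IsUniformlyCk.succ_iff.2 ⟨fun i x => (hder i x).differentiableAt,
      ⟨B, fun i x => hB i _ (hKW i x)⟩, ?_⟩
    -- The induction hypothesis is applied to the derivative of `f`, whose values are operators;
    -- this is why the target space is quantified inside the induction.
    have h1 := ih (hK.of_le (Nat.le_succ s)) (hf.fderiv_family hW)
    have h2 := (hK'.clm_comp (ContinuousLinearMap.compL ℝ X Y (Y × X)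
      (ContinuousLinearMap.inl ℝ Y X))).add
      (IsUniformlyCk.const s (ContinuousLinearMap.inr ℝ Y X))
    have h3 := h1.bilinear h2 (ContinuousLinearMap.compL ℝ X (Y × X) E)
    convert h3 using 3 with i x
    rw [(hder i x).fderiv]
    ext v
    simp [← map_add]

/-! ### Smooth dependence of bounded solutions on a parameter. -/

section Linear

/-- In the product rule the derivative of `v` is multiplied by `a x = 0`, so continuity of `v` is
enough. This allows a solution not yet known to be differentiable to appear in the forcing. -/
theorem hasFDerivAt_clm_apply_of_eq_zero {X E F : Type*} [NormedAddCommGroup X] [NormedSpace ℝ X]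
    [NormedAddCommGroup E] [NormedSpace ℝ E] [NormedAddCommGroup F] [NormedSpace ℝ F]
    {a : X → E →L[ℝ] F} {a' : X →L[ℝ] E →L[ℝ] F} {v : X → E} {x : X}
    (ha : HasFDerivAt a a' x) (h0 : a x = 0) (hv : ContinuousAt v x) :
    HasFDerivAt (fun y => a y (v y)) (a'.flip (v x)) x := by
  rw [hasFDerivAt_iff_isLittleO] at ha ⊢
  simp only [h0, _root_.zero_apply, sub_zero, ContinuousLinearMap.flip_apply] at ha ⊢
  have e : (fun y => a y (v y) - a' (y - x) (v x)) =
      fun y => (a y - a' (y - x)) (v y) + a' (y - x) (v y - v x) := by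
    ext y
    rw [_root_.sub_apply, map_sub (a' (y - x))]
    abel
  rw [e]
  refine Asymptotics.IsLittleO.add ?_ ?_
  · have hb : (fun y => v y) =O[𝓝 x] (fun _ => (1 : ℝ)) := hv.isBigO_one ℝ
    have := ha.norm_norm.mul_isBigO hb.norm_left
    simp only [mul_one] at this
    refine Asymptotics.IsBigO.trans_isLittleO (Asymptotics.IsBigO.of_bound 1 ?_)
      this.of_norm_right
    filter_upwards with y
    rw [one_mul, norm_mul, norm_norm, norm_norm]
    exact (a y - a' (y - x)).le_opNorm _
  · have h1 : (fun y => v y - v x) =o[𝓝 x] (fun _ => (1 : ℝ)) := by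
      rw [Asymptotics.isLittleO_one_iff]
      exact tendsto_sub_nhds_zero_iff.2 hv
    have h2 : (fun y => a' (y - x)) =O[𝓝 x] (fun y => y - x) := a'.isBigO_comp _ _
    have := h2.norm_norm.mul_isLittleO h1.norm_left
    simp only [mul_one] at this
    refine Asymptotics.IsBigO.trans_isLittleO (Asymptotics.IsBigO.of_bound 1 ?_) this.of_norm_right
    filter_upwards with y
    rw [one_mul, norm_mul, norm_norm, norm_norm]
    exact (a' (y - x)).le_opNorm _

/-- Differentiability of bounded solutions with respect to a parameter. -/
theorem IsDichotomous.hasFDerivAt {X E : Type*} [NormedAddCommGroup X] [NormedSpace ℝ X]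
    [NormedAddCommGroup E] [NormedSpace ℝ E] {A : ℤ → E →L[ℝ] E} {C μ : ℝ}
    (h : IsDichotomous A C μ) {u q : ℤ → X → E} {V b : ℤ → X →L[ℝ] E} {x : X} {L : ℝ}
    (hu : ∃ B, ∀ k y, ‖u k y‖ ≤ B) (heq : ∀ k y, u (k + 1) y = A k (u k y) + q k y)
    (hq : ∀ᶠ y in 𝓝 x, ∀ k, ‖q k y - q k x‖ ≤ L * ‖y - x‖)
    (hqd : ∀ k, HasFDerivAt (q k) (b k) x) (hb : ∃ B, ∀ k, ‖b k‖ ≤ B)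
    (hV : ∃ B, ∀ k, ‖V k‖ ≤ B) (hVeq : ∀ k, V (k + 1) = (A k).comp (V k) + b k) (k : ℤ) :
    HasFDerivAt (u k) (V k) x := by
  obtain ⟨Bu, hBu⟩ := hu
  obtain ⟨Bb, hBb⟩ := hb
  obtain ⟨BV, hBV⟩ := hV
  rw [hasFDerivAt_iff_tendsto]
  -- The normalized Taylor remainder of `u` solves the linear equation forced by that of `q`, which
  -- is bounded uniformly in `k` and tends to zero for each `k`. The a priori bound on the remainder
  -- of `u` may blow up as `y → x`; it only identifies the bounded solution.
  have key := h.tendsto_zero (l := 𝓝 x) (b := |L| + |Bb|)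
    (w := fun y k => ‖y - x‖⁻¹ • (u k y - u k x - V k (y - x)))
    (g := fun y k => ‖y - x‖⁻¹ • (q k y - q k x - b k (y - x))) ?_ ?_ ?_ ?_ k
  · have := key.norm
    simpa [norm_smul] using this
  · refine Eventually.of_forall fun y => ⟨‖y - x‖⁻¹ * (Bu + Bu + BV * ‖y - x‖), fun k => ?_⟩
    rw [norm_smul, norm_inv, norm_norm]
    refine mul_le_mul_of_nonneg_left ?_ (by positivity)
    exact (norm_sub_le _ _).trans (add_le_add ((norm_sub_le _ _).trans
      (add_le_add (hBu _ _) (hBu _ _))) ((V k).le_of_opNorm_le (hBV k) _))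
  · filter_upwards [hq] with y hy k
    rw [norm_smul, norm_inv, norm_norm]
    rcases eq_or_ne y x with rfl | hyx
    · simp
      positivity
    · have hpos : 0 < ‖y - x‖ := norm_pos_iff.2 (sub_ne_zero.2 hyx)
      rw [inv_mul_le_iff₀ hpos, mul_comm, add_mul]
      refine (norm_sub_le _ _).trans (add_le_add ((hy k).trans ?_) ?_)
      · exact mul_le_mul_of_nonneg_right (le_abs_self _) (norm_nonneg _)
      · exact (b k).le_of_opNorm_le ((hBb k).trans (le_abs_self _)) _
  · refine Eventually.of_forall fun y k => ?_
    rw [map_smul, ← smul_add, heq, heq, hVeq]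
    congr 1
    simp only [map_sub, _root_.add_apply, ContinuousLinearMap.comp_apply]
    abel
  · intro k
    have := hasFDerivAt_iff_tendsto.1 (hqd k)
    rw [tendsto_zero_iff_norm_tendsto_zero]
    simpa [norm_smul] using this

/-- Bounded solutions of a linear difference equation are as smooth in a parameter as the
coefficients. -/
theorem isUniformlyCk_of_linear {κ : Type*} {X : Type} [NormedAddCommGroup X] [NormedSpace ℝ X]
    {C μ : ℝ} (s : ℕ) : ∀ {E : Type} [NormedAddCommGroup E] [NormedSpace ℝ E]
    {A : κ × ℤ → X → E →L[ℝ] E} {b V : κ × ℤ → X → E}, IsUniformlyCk s A → IsUniformlyCk s b →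
    (∃ B, ∀ p x, ‖V p x‖ ≤ B) → (∀ c x, IsDichotomous (fun k => A (c, k) x) C μ) →
    (∀ c k x, V (c, k + 1) x = A (c, k) x (V (c, k) x) + b (c, k) x) → IsUniformlyCk s V := by
  induction s with
  | zero =>
    intro E _ _ A b V hA hb hV hD heq
    obtain ⟨hAc, BA, hBA⟩ := isUniformlyCk_zero.1 hA
    obtain ⟨hbc, Bb, hBb⟩ := isUniformlyCk_zero.1 hb
    refine isUniformlyCk_zero.2 ⟨fun p => ?_, hV⟩
    obtain ⟨BV, hBV⟩ := hV
    obtain ⟨c, k⟩ := p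
    refine continuous_iff_continuousAt.2 fun x => ?_
    -- The coefficient is frozen at `x`, and its variation is moved into the forcing.
    have key := (hD c x).tendsto_zero (l := 𝓝 x) (b := (BA + BA) * BV + (Bb + Bb))
      (w := fun y k => V (c, k) y - V (c, k) x)
      (g := fun y k => (A (c, k) y - A (c, k) x) (V (c, k) y) + (b (c, k) y - b (c, k) x))
      ?_ ?_ ?_ ?_ k
    · exact tendsto_sub_nhds_zero_iff.1 key
    · exact Eventually.of_forall fun y => ⟨BV + BV, fun k =>
        (norm_sub_le _ _).trans (add_le_add (hBV _ _) (hBV _ _))⟩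
    · refine Eventually.of_forall fun y k => ?_
      have h1 : ‖A (c, k) y - A (c, k) x‖ ≤ BA + BA :=
        (norm_sub_le _ _).trans (add_le_add (hBA _ _) (hBA _ _))
      exact (norm_add_le _ _).trans (add_le_add
        (((A (c, k) y - A (c, k) x).le_opNorm _).trans
          (mul_le_mul h1 (hBV _ _) (norm_nonneg _) ((norm_nonneg _).trans h1)))
        ((norm_sub_le _ _).trans (add_le_add (hBb _ _) (hBb _ _))))
    · refine Eventually.of_forall fun y k => ?_
      rw [heq, heq, map_sub, _root_.sub_apply]
      abel
    · intro k
      have h1 : Tendsto (fun y => A (c, k) y - A (c, k) x) (𝓝 x) (𝓝 0) :=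
        tendsto_sub_nhds_zero_iff.2 ((hAc (c, k)).tendsto x)
      have h2 : Tendsto (fun y => b (c, k) y - b (c, k) x) (𝓝 x) (𝓝 0) :=
        tendsto_sub_nhds_zero_iff.2 ((hbc (c, k)).tendsto x)
      rw [← add_zero (0 : E)]
      refine Tendsto.add ?_ h2
      refine squeeze_zero_norm (a := fun y => ‖A (c, k) y - A (c, k) x‖ * BV) (fun y =>
        ((A (c, k) y - A (c, k) x).le_opNorm _).trans
          (mul_le_mul_of_nonneg_left (hBV _ _) (norm_nonneg _))) ?_
      simpa using h1.norm.mul_const BV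
  | succ s ih =>
    intro E _ _ A b V hA hb hV hD heq
    have hVs : IsUniformlyCk s V :=
      ih (hA.of_le (Nat.le_succ s)) (hb.of_le (Nat.le_succ s)) hV hD heq
    obtain ⟨BV, hBV⟩ := hV
    obtain ⟨hAd, -, hA'⟩ := IsUniformlyCk.succ_iff.1 hA
    obtain ⟨hbd, -, hb'⟩ := IsUniformlyCk.succ_iff.1 hb
    obtain ⟨LA, hLA⟩ := hA.lipschitz
    obtain ⟨Lb, hLb⟩ := hb.lipschitz
    have hVc : ∀ p, Continuous (V p) := fun p => (hVs.1 p).continuous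
    let flipL := (ContinuousLinearMap.flipₗᵢ ℝ X E E).toContinuousLinearEquiv.toContinuousLinearMap
    have hb2 : IsUniformlyCk s
        (fun p x => flipL (fderiv ℝ (A p) x) (V p x) + fderiv ℝ (b p) x) :=
      (hA'.bilinear hVs flipL).add hb'
    set b' : κ × ℤ → X → X →L[ℝ] E :=
      fun p x => flipL (fderiv ℝ (A p) x) (V p x) + fderiv ℝ (b p) x with hb'def
    obtain ⟨Bb', hBb'⟩ := hb2.bounded
    have hD' := fun c x => (hD c x).compL X
    -- The candidate derivative is the bounded solution of the formally differentiated equation.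
    choose V' hV'b hV'eq using fun c x =>
      (hD' c x).exists_solution (fun k => b' (c, k) x) ⟨Bb', fun k => hBb' _ _⟩
    have hV'bound := fun c x k =>
      (hD' c x).norm_le (hV'b c x) (fun k => hBb' (c, k) x) (hV'eq c x) k
    have hder : ∀ c k x, HasFDerivAt (V (c, k)) (V' c x k) x := by
      intro c k x
      refine (hD c x).hasFDerivAt (u := fun k => V (c, k)) (V := V' c x) (L := LA * BV + Lb)
        (q := fun k y => (A (c, k) y - A (c, k) x) (V (c, k) y) + b (c, k) y)
        (b := fun k => b' (c, k) x) ⟨BV, fun k y => hBV _ _⟩ ?_ ?_ ?_ ⟨Bb', fun k => hBb' _ _⟩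
        (hV'b c x) (fun k => by rw [hV'eq]; rfl) k
      · intro k y
        rw [heq, _root_.sub_apply]
        abel
      · refine Eventually.of_forall fun y k => ?_
        simp only [sub_self, _root_.zero_apply, zero_add]
        rw [add_sub_assoc, add_mul]
        refine (norm_add_le _ _).trans (add_le_add ?_ (hLb _ _ _))
        refine ((A (c, k) y - A (c, k) x).le_opNorm _).trans ?_
        rw [mul_right_comm]
        exact mul_le_mul (hLA _ _ _) (hBV _ _) (norm_nonneg _)
          ((norm_nonneg _).trans (hLA (c, k) x y))
      · intro k
        have h1 : HasFDerivAt (fun y => A (c, k) y - A (c, k) x) (fderiv ℝ (A (c, k)) x) x :=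
          (hAd (c, k) x).hasFDerivAt.sub_const _
        exact (hasFDerivAt_clm_apply_of_eq_zero h1 (sub_self _) (hVc (c, k)).continuousAt).add
          (hbd (c, k) x).hasFDerivAt
    have hfd : (fun p => fderiv ℝ (V p)) = fun (p : κ × ℤ) x => V' p.1 x p.2 := by
      ext1 p
      ext1 x
      exact (hder p.1 p.2 x).fderiv
    refine IsUniformlyCk.succ_iff.2 ⟨fun p x => (hder p.1 p.2 x).differentiableAt,
      ⟨BV, hBV⟩, ?_⟩
    rw [hfd]
    let cL : (E →L[ℝ] E) →L[ℝ] (X →L[ℝ] E) →L[ℝ] (X →L[ℝ] E) := ContinuousLinearMap.compL ℝ X E E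
    have hA2 := IsUniformlyCk.clm_comp (E := E →L[ℝ] E)
      (F := (X →L[ℝ] E) →L[ℝ] (X →L[ℝ] E)) (hA.of_le (Nat.le_succ s)) cL
    -- The derivative solves an equation of the same type, whose forcing contains `V` itself and is
    -- `C^s` because `V` already is.
    exact ih hA2 hb2 ⟨_, fun p x => hV'bound p.1 x p.2⟩ hD' (fun c k x => hV'eq c x k)

end Linear

/-! ### From continuity to Lipschitz regularity, and from Lipschitz to `C^r`. -/

section Bootstrap

variable {κ : Type*} {X Y : Type} [NormedAddCommGroup X] [NormedSpace ℝ X]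
  [NormedAddCommGroup Y] [NormedSpace ℝ Y]

/-- The partial derivative in the first variable, as an operator. -/
def partialFst (X Y : Type) [NormedAddCommGroup X] [NormedSpace ℝ X]
    [NormedAddCommGroup Y] [NormedSpace ℝ Y] (L : Y × X →L[ℝ] Y) : Y →L[ℝ] Y :=
  L.comp (ContinuousLinearMap.inl ℝ Y X)

theorem norm_partialFst_le (L : Y × X →L[ℝ] Y) : ‖partialFst X Y L‖ ≤ ‖L‖ :=
  (L.opNorm_comp_le _).trans
    (mul_le_of_le_one_right (norm_nonneg _) (ContinuousLinearMap.norm_inl_le_one ℝ Y X))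

/-- Subtracting the linear part in the first variable removes the only first-order term that would
need a derivative of `K`. The Lipschitz bound turns the remainder of `f` into `o(‖y - x‖)`. -/
theorem hasFDerivAt_of_lipschitz_graph {f : Y × X → Y} {K : X → Y} {x : X} {L : ℝ}
    (hf : DifferentiableAt ℝ f (K x, x)) (hK : ∀ᶠ y in 𝓝 x, ‖K y - K x‖ ≤ L * ‖y - x‖) :
    HasFDerivAt (fun y => f (K y, y) - partialFst X Y (fderiv ℝ f (K x, x)) (K y))
      ((fderiv ℝ f (K x, x)).comp (ContinuousLinearMap.inr ℝ Y X)) x := by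
  have hO : (fun y => ((K y, y) : Y × X) - (K x, x)) =O[𝓝 x] fun y => y - x := by
    refine Asymptotics.IsBigO.of_bound (max L 1) ?_
    filter_upwards [hK] with y hy
    rw [Prod.mk_sub_mk, Prod.norm_mk]
    refine max_le (hy.trans ?_) ?_
    · exact mul_le_mul_of_nonneg_right (le_max_left _ _) (norm_nonneg _)
    · exact le_mul_of_one_le_left (norm_nonneg _) (le_max_right _ _)
  have hKc : Tendsto (fun y => ((K y, y) : Y × X)) (𝓝 x) (𝓝 (K x, x)) := by
    rw [← tendsto_sub_nhds_zero_iff]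
    refine hO.trans_tendsto ?_
    exact tendsto_sub_nhds_zero_iff.2 tendsto_id
  have h1 := (hasFDerivAt_iff_isLittleO.1 hf.hasFDerivAt).comp_tendsto hKc
  rw [hasFDerivAt_iff_isLittleO]
  refine (h1.trans_isBigO hO).congr_left fun y => ?_
  simp only [Function.comp, partialFst, ContinuousLinearMap.comp_apply,
    ContinuousLinearMap.inl_apply, ContinuousLinearMap.inr_apply]
  have : ((K y, y) : Y × X) - (K x, x) = (K y, 0) - (K x, 0) + (0, y - x) := by simp
  rw [this, map_add, map_sub]
  abel

/-- Bootstrap: a locally Lipschitz invariant family of a uniformly `C^r` family of maps, with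
uniform dichotomy along it, is uniformly `C^r`. -/
theorem isUniformlyCk_of_invariant {U : Set Y} (hU : IsOpen U) {r : ℕ}
    {f : κ × ℤ → Y × X → Y} (hf : IsUniformlyCkOn (r + 1) (U ×ˢ univ) f)
    {K : κ × ℤ → X → Y} (hK : IsUniformlyCk 0 K) (hKU : ∀ p x, K p x ∈ U)
    (heq : ∀ c k x, K (c, k + 1) x = f (c, k) (K (c, k) x, x)) {C μ : ℝ}
    (hD : ∀ c x, IsDichotomous
      (fun k => partialFst X Y (fderiv ℝ (f (c, k)) (K (c, k) x, x))) C μ) {L : ℝ}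
    (hLip : ∀ c x, ∀ᶠ y in 𝓝 x, ∀ k, ‖K (c, k) y - K (c, k) x‖ ≤ L * ‖y - x‖)
    (s : ℕ) (hs : s ≤ r + 1) : IsUniformlyCk s K := by
  induction s with
  | zero => exact hK
  | succ s ih =>
    have hKs := ih (by omega)
    have hW : IsOpen (U ×ˢ (univ : Set X)) := hU.prod isOpen_univ
    have hKW : ∀ p x, (K p x, x) ∈ U ×ˢ (univ : Set X) := fun p x => ⟨hKU p x, mem_univ _⟩
    have hDf : IsUniformlyCk s (fun p x => fderiv ℝ (f p) (K p x, x)) :=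
      IsUniformlyCkOn.comp_graph hW hKW hKs ((hf.fderiv_family hW).of_le (by omega))
    obtain ⟨BK, hBK⟩ := hK.bounded
    obtain ⟨BD, hBD⟩ := hDf.bounded
    have hA : IsUniformlyCk s (fun p x => partialFst X Y (fderiv ℝ (f p) (K p x, x))) :=
      IsUniformlyCk.clm_comp (E := Y × X →L[ℝ] Y) (F := Y →L[ℝ] Y) hDf
        ((ContinuousLinearMap.compL ℝ Y (Y × X) Y).flip (ContinuousLinearMap.inl ℝ Y X))
    have hb : IsUniformlyCk s (fun p x => (fderiv ℝ (f p) (K p x, x)).comp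
        (ContinuousLinearMap.inr ℝ Y X)) :=
      IsUniformlyCk.clm_comp (E := Y × X →L[ℝ] Y) (F := X →L[ℝ] Y) hDf
        ((ContinuousLinearMap.compL ℝ X (Y × X) Y).flip (ContinuousLinearMap.inr ℝ Y X))
    obtain ⟨Bb, hBb⟩ := hb.bounded
    have hD' := fun c x => (hD c x).compL X
    choose V hVb hVeq using fun c x => (hD' c x).exists_solution
      (fun k => (fderiv ℝ (f (c, k)) (K (c, k) x, x)).comp (ContinuousLinearMap.inr ℝ Y X))
      ⟨Bb, fun k => hBb _ _⟩
    have hVbound := fun c x k => (hD' c x).norm_le (hVb c x) (fun k => hBb (c, k) x) (hVeq c x) k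
    have hder : ∀ c k x, HasFDerivAt (K (c, k)) (V c x k) x := by
      intro c k x
      refine (hD c x).hasFDerivAt (u := fun k => K (c, k)) (V := V c x) (L := L + BD * L)
        (q := fun k y => f (c, k) (K (c, k) y, y) -
          partialFst X Y (fderiv ℝ (f (c, k)) (K (c, k) x, x)) (K (c, k) y))
        (b := fun k => (fderiv ℝ (f (c, k)) (K (c, k) x, x)).comp
          (ContinuousLinearMap.inr ℝ Y X))
        ⟨BK, fun k y => hBK _ _⟩ ?_ ?_ ?_ ⟨Bb, fun k => hBb _ _⟩ (hVb c x)
        (fun k => hVeq c x k) k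
      · intro k y
        rw [heq]
        abel
      -- By invariance the forcing is `K_{k+1}` minus the linear image of `K_k`, so its Lipschitz
      -- bound is inherited from `K`.
      · filter_upwards [hLip c x] with y hy k
        rw [← heq, ← heq, sub_sub_sub_comm, ← map_sub, add_mul, mul_assoc]
        refine (norm_sub_le _ _).trans (add_le_add (hy _) ?_)
        refine (ContinuousLinearMap.le_opNorm _ _).trans (mul_le_mul
          ((norm_partialFst_le _).trans (hBD (c, k) x)) (hy k) (norm_nonneg _)
          ((norm_nonneg _).trans (hBD (c, k) x)))
      · intro k
        exact hasFDerivAt_of_lipschitz_graph (hf.differentiableAt hW _ (hKW _ _))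
          ((hLip c x).mono fun y hy => hy k)
    have hfd : (fun p => fderiv ℝ (K p)) = fun (p : κ × ℤ) x => V p.1 x p.2 := by
      ext1 p
      ext1 x
      exact (hder p.1 p.2 x).fderiv
    refine IsUniformlyCk.succ_iff.2 ⟨fun p x => (hder p.1 p.2 x).differentiableAt,
      ⟨BK, hBK⟩, ?_⟩
    rw [hfd]
    let cL : (Y →L[ℝ] Y) →L[ℝ] (X →L[ℝ] Y) →L[ℝ] (X →L[ℝ] Y) := ContinuousLinearMap.compL ℝ X Y Y
    have hA2 := IsUniformlyCk.clm_comp (E := Y →L[ℝ] Y)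
      (F := (X →L[ℝ] Y) →L[ℝ] (X →L[ℝ] Y)) hA cL
    exact isUniformlyCk_of_linear s hA2 hb ⟨_, fun p x => hVbound p.1 x p.2⟩ hD'
      (fun c k x => hVeq c x k)

/-- If the oscillation of a sequence of maps is controlled on windows recurring in both time
directions, then hyperbolicity makes the sequence locally uniformly Lipschitz. -/
theorem exists_uniform_lipschitz {f : κ × ℤ → Y × X → Y} {K : κ × ℤ → X → Y} {BK BA B C μ : ℝ}
    {A : κ × ℤ → X → Y →L[ℝ] Y}
    (hK : ∀ p x, ‖K p x‖ ≤ BK) (hA : ∀ p x, ‖A p x‖ ≤ BA)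
    (heq : ∀ c k x, K (c, k + 1) x = f (c, k) (K (c, k) x, x))
    (hD : ∀ c x, IsDichotomous (fun k => A (c, k) x) C μ)
    (hfB : ∀ p x y, ‖f p (K p y, y) - f p (K p y, x)‖ ≤ B * ‖y - x‖)
    (hrem : ∀ η : ℝ, 0 < η → ∃ δ : ℝ, 0 < δ ∧ ∀ p x y, ‖K p y - K p x‖ ≤ δ →
      ‖f p (K p y, x) - f p (K p x, x) - A p x (K p y - K p x)‖ ≤ η * ‖K p y - K p x‖)
    (hUC : ∀ p, UniformContinuous (K p))
    (hrec : ∀ ε : ℝ, 0 < ε → ∀ (N : ℕ) (c : κ), ∃ s : ℝ, 0 < s ∧ ∀ k : ℤ, ∃ a ≤ k, ∃ b ≥ k,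
      ∀ j : ℤ, ((j - a).natAbs ≤ N ∨ (j - b).natAbs ≤ N) →
        ∀ x y, ‖y - x‖ < s → ‖K (c, j) y - K (c, j) x‖ ≤ ε) :
    ∃ L : ℝ, ∀ c, ∃ s : ℝ, 0 < s ∧ ∀ x y, ‖y - x‖ < s →
      ∀ k, ‖K (c, k) y - K (c, k) x‖ ≤ L * ‖y - x‖ := by
  rcases isEmpty_or_nonempty κ with hκ | ⟨⟨c0⟩⟩
  · exact ⟨0, fun c => hκ.elim c⟩
  have hD0 := hD c0 0
  have hBK0 : 0 ≤ BK := (norm_nonneg _).trans (hK (c0, 0) 0)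
  have hBA0 : 0 ≤ BA := (norm_nonneg _).trans (hA (c0, 0) 0)
  have hC := hD0.const_nonneg
  set T : ℝ := C * ∑' i : ℤ, μ ^ i.natAbs with hT
  have hT0 : 0 ≤ T := mul_nonneg hC (tsum_nonneg fun i => pow_nonneg hD0.rate_nonneg _)
  -- `T` is the norm of the Green operator on bounded sequences; this `η` gives `T * η ≤ 1 / 8`, so
  -- the nonlinear remainder can be absorbed.
  obtain ⟨δ, hδ, hδr⟩ := hrem (1 / (8 * (T + 1))) (by positivity)
  set η : ℝ := 1 / (8 * (T + 1)) with hη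
  have hη0 : 0 < η := by positivity
  have hTη : T * η ≤ 1 / 8 := by
    rw [hη, mul_one_div, div_le_div_iff₀ (by positivity) (by norm_num)]
    linarith
  set G : ℝ := (BK + BK) + BA * (BK + BK) with hG
  have hG0 : 0 ≤ G := by positivity
  -- Outside the window only the crude bound `G` on the forcing is available; this `N` makes its
  -- contribution at most `δ / 8`.
  obtain ⟨N, hN⟩ := exists_tail_lt hD0.rate_nonneg hD0.rate_lt_one
    (show 0 < δ / (8 * (C * G + 1)) by positivity)
  have hwb : ∀ p x y, ‖K p y - K p x‖ ≤ BK + BK := fun p x y =>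
    (norm_sub_le _ _).trans (add_le_add (hK _ _) (hK _ _))
  set g : κ → X → X → ℤ → Y := fun c x y k =>
    K (c, k + 1) y - K (c, k + 1) x - A (c, k) x (K (c, k) y - K (c, k) x) with hg
  have hweq : ∀ c x y k, K (c, k + 1) y - K (c, k + 1) x =
      A (c, k) x (K (c, k) y - K (c, k) x) + g c x y k := fun c x y k => by simp [hg]
  have hgG : ∀ c x y k, ‖g c x y k‖ ≤ G := fun c x y k =>
    (norm_sub_le _ _).trans (add_le_add (hwb _ _ _) ((ContinuousLinearMap.le_opNorm _ _).trans
      (mul_le_mul (hA _ _) (hwb _ _ _) (norm_nonneg _) hBA0)))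
  have hgη : ∀ c x y k, ‖K (c, k) y - K (c, k) x‖ ≤ δ →
      ‖g c x y k‖ ≤ η * ‖K (c, k) y - K (c, k) x‖ + B * ‖y - x‖ := by
    intro c x y k hk
    have e : g c x y k = (f (c, k) (K (c, k) y, x) - f (c, k) (K (c, k) x, x) -
        A (c, k) x (K (c, k) y - K (c, k) x)) +
        (f (c, k) (K (c, k) y, y) - f (c, k) (K (c, k) y, x)) := by
      simp only [hg, heq]
      abel
    rw [e]
    exact (norm_add_le _ _).trans (add_le_add (hδr _ x y hk) (hfB _ _ _))
  have hB' : ∀ x y : X, 0 ≤ B * ‖y - x‖ := fun x y => (norm_nonneg _).trans (hfB (c0, 0) x y)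
  -- small on a window implies twice as small at its centre
  have hhalf : ∀ c x y k, (∀ j : ℤ, (k - j).natAbs ≤ N → ‖K (c, j) y - K (c, j) x‖ ≤ δ) →
      T * (B * ‖y - x‖) ≤ δ / 4 → ‖K (c, k) y - K (c, k) x‖ ≤ δ / 2 := by
    intro c x y k hj hxy
    have h := (hD c x).norm_le_of_window (N := N) (w := fun k => K (c, k) y - K (c, k) x)
      (g := g c x y) (b := η * δ + B * ‖y - x‖) (b' := G)
      (add_nonneg (by positivity) (hB' x y)) ⟨_, fun k => hwb (c, k) x y⟩ k
      (fun j hjN => (hgη c x y j (hj j hjN)).trans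
        (add_le_add (mul_le_mul_of_nonneg_left (hj j hjN) hη0.le) le_rfl))
      (hgG c x y) (hweq c x y)
    refine h.trans ?_
    have h1 : T * (η * δ + B * ‖y - x‖) ≤ 1 / 8 * δ + δ / 4 := by
      rw [mul_add, ← mul_assoc]
      exact add_le_add (mul_le_mul_of_nonneg_right hTη hδ.le) hxy
    have h2 : C * (∑' i : ℤ, μ ^ i.natAbs * (if N < i.natAbs then (1 : ℝ) else 0)) * G ≤
        δ / 8 := by
      have hCG : 0 ≤ C * G := mul_nonneg hC hG0
      calc _ = C * G * (∑' i : ℤ, μ ^ i.natAbs * (if N < i.natAbs then (1 : ℝ) else 0)) := by ring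
        _ ≤ C * G * (δ / (8 * (C * G + 1))) := mul_le_mul_of_nonneg_left hN.le hCG
        _ ≤ δ / 8 := by
          rw [mul_div_assoc', div_le_div_iff₀ (by positivity) (by norm_num)]
          nlinarith
    linarith
  -- a scale below which the forcing is negligible
  obtain ⟨t0, ht0, ht0B⟩ : ∃ t0 : ℝ, 0 < t0 ∧ ∀ x y : X, ‖y - x‖ < t0 →
      T * (B * ‖y - x‖) ≤ δ / 4 := by
    refine ⟨δ / (4 * (T * |B| + 1)), by positivity, fun x y hxy => ?_⟩
    rw [lt_div_iff₀ (by positivity)] at hxy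
    have h1 : B * ‖y - x‖ ≤ |B| * ‖y - x‖ :=
      mul_le_mul_of_nonneg_right (le_abs_self B) (norm_nonneg _)
    have h2 := mul_le_mul_of_nonneg_left h1 hT0
    have h3 := norm_nonneg (y - x)
    nlinarith
  -- Points at distance less than `2 * t` are joined through their midpoint, and each half
  -- contributes at most `δ / 2`.
  have hdouble : ∀ c (t : ℝ), 0 < t → t ≤ t0 → ∀ k : ℤ, (∀ j : ℤ, (k - j).natAbs ≤ N →
      ∀ x y, ‖y - x‖ < t → ‖K (c, j) y - K (c, j) x‖ ≤ δ) →
      ∀ x y, ‖y - x‖ < 2 * t → ‖K (c, k) y - K (c, k) x‖ ≤ δ := by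
    intro c t ht htt k hj x y hxy
    have e1 : midpoint ℝ x y - x = (2⁻¹ : ℝ) • (y - x) := by
      rw [midpoint_sub_left]; simp
    have e2 : y - midpoint ℝ x y = (2⁻¹ : ℝ) • (y - x) := by
      rw [right_sub_midpoint]; simp
    have hn : ‖(2⁻¹ : ℝ) • (y - x)‖ < t := by
      rw [norm_smul]; norm_num; linarith
    have a1 : ‖midpoint ℝ x y - x‖ < t := by rwa [e1]
    have a2 : ‖y - midpoint ℝ x y‖ < t := by rwa [e2]
    have h1 := hhalf c x (midpoint ℝ x y) k (fun j hjN => hj j hjN _ _ a1)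
      (ht0B _ _ (a1.trans_le htt))
    have h2 := hhalf c (midpoint ℝ x y) y k (fun j hjN => hj j hjN _ _ a2)
      (ht0B _ _ (a2.trans_le htt))
    have := norm_sub_le_norm_sub_add_norm_sub (K (c, k) y) (K (c, k) (midpoint ℝ x y)) (K (c, k) x)
    linarith
  refine ⟨2 * (T * B), fun c => ?_⟩
  obtain ⟨s, hs, hsr⟩ := hrec δ hδ N c
  have hs' : 0 < min s t0 := lt_min hs ht0
  -- Finitely many uniformly continuous maps on `[a, b]` share a scale `s0`, which depends on `k`.
  -- Doubling lifts it to `min s t0`, which does not. A window centred in `[a, b]` that sticks out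
  -- does so within `N` of `a` or `b`, where recurrence already gives the scale `s`.
  have hall : ∀ k x y, ‖y - x‖ < min s t0 → ‖K (c, k) y - K (c, k) x‖ ≤ δ := by
    intro k
    obtain ⟨a, hak, b, hbk, hab⟩ := hsr k
    obtain ⟨s0, hs0, hs0w⟩ : ∃ s0 : ℝ, 0 < s0 ∧ ∀ j ∈ Finset.Icc a b, ∀ x y,
        ‖y - x‖ < s0 → ‖K (c, j) y - K (c, j) x‖ ≤ δ := by
      have : ∀ j ∈ Finset.Icc a b, ∀ᶠ t in 𝓝[>] (0 : ℝ), ∀ x y,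
          ‖y - x‖ < t → ‖K (c, j) y - K (c, j) x‖ ≤ δ := by
        intro j _
        obtain ⟨e, he, hej⟩ := Metric.uniformContinuous_iff.1 (hUC (c, j)) δ hδ
        filter_upwards [Ioo_mem_nhdsGT he] with t ht x y hxy
        have := hej (a := y) (b := x) (by rw [dist_eq_norm]; exact hxy.trans ht.2)
        rw [dist_eq_norm] at this
        exact this.le
      have h2 := (Filter.eventually_all_finset (Finset.Icc a b)).2 this
      obtain ⟨t, ht1, ht2⟩ := (h2.and self_mem_nhdsWithin).exists
      exact ⟨t, ht2, ht1⟩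
    have hi : ∀ i : ℕ, ∀ j ∈ Finset.Icc a b, ∀ x y,
        ‖y - x‖ < min (2 ^ i * s0) (min s t0) → ‖K (c, j) y - K (c, j) x‖ ≤ δ := by
      intro i
      induction i with
      | zero =>
        intro j hj x y hxy
        exact hs0w j hj x y (by simpa using hxy.trans_le (min_le_left _ _))
      | succ i ih =>
        intro j hj x y hxy
        have hpos : 0 < min (2 ^ i * s0) (min s t0) := lt_min (by positivity) hs'
        refine hdouble c _ hpos ((min_le_right _ _).trans (min_le_right _ _)) j ?_ x y
          (hxy.trans_le ?_)
        · intro j' hj' x y hxy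
          by_cases hm : j' ∈ Finset.Icc a b
          · exact ih j' hm x y hxy
          · rw [Finset.mem_Icc] at hm hj
            exact hab j' (by omega) x y
              (hxy.trans_le ((min_le_right _ _).trans (min_le_left _ _)))
        · rw [mul_min_of_nonneg _ _ (by norm_num : (0 : ℝ) ≤ 2), ← mul_assoc, ← pow_succ']
          exact min_le_min le_rfl (by linarith)
    obtain ⟨i, hi2⟩ := pow_unbounded_of_one_lt (min s t0 / s0) (by norm_num : (1 : ℝ) < 2)
    rw [div_lt_iff₀ hs0] at hi2
    intro x y hxy
    exact hi i k (Finset.mem_Icc.2 ⟨hak, hbk⟩) x y (by rwa [min_eq_right hi2.le])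
  refine ⟨min s t0, hs', fun x y hxy => ?_⟩
  have hbdd : BddAbove (range fun k => ‖K (c, k) y - K (c, k) x‖) :=
    ⟨_, by rintro _ ⟨k, rfl⟩; exact hwb (c, k) x y⟩
  set W : ℝ := ⨆ k, ‖K (c, k) y - K (c, k) x‖ with hW
  have hkW : ∀ k, ‖K (c, k) y - K (c, k) x‖ ≤ W := fun k => le_ciSup hbdd k
  have hkT : ∀ k, ‖K (c, k) y - K (c, k) x‖ ≤ T * (η * W + B * ‖y - x‖) := fun k =>
    (hD c x).norm_le (w := fun k => K (c, k) y - K (c, k) x) (g := g c x y)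
      ⟨_, fun k => hwb (c, k) x y⟩ (fun j => (hgη c x y j (hall j x y hxy)).trans
        (add_le_add (mul_le_mul_of_nonneg_left (hkW j) hη0.le) le_rfl)) (hweq c x y) k
  -- Smallness now holds at all times, so the remainder is absorbed in the supremum: `W ≤ W / 8 + T
  -- * B * ‖y - x‖`, which leaves room for the factor `2` in the Lipschitz constant.
  have hWle : W ≤ T * (η * W + B * ‖y - x‖) := ciSup_le hkT
  have hW0 : 0 ≤ W := (norm_nonneg _).trans (hkW 0)
  have h1 := mul_le_mul_of_nonneg_right hTη hW0
  intro k
  refine (hkW k).trans ?_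
  have h2 := mul_nonneg hT0 (hB' x y)
  have h3 : W ≤ 1 / 8 * W + T * (B * ‖y - x‖) := by
    calc W ≤ _ := hWle
      _ = T * η * W + T * (B * ‖y - x‖) := by ring
      _ ≤ _ := by linarith
  linarith

end Bootstrap

/-! ### Uniform first-order expansion of the maps along the torus. -/

section Remainder

variable {ι : Type*} {X Y : Type} [NormedAddCommGroup X] [NormedSpace ℝ X]
  [NormedAddCommGroup Y] [NormedSpace ℝ Y]

theorem hasFDerivAt_fst {f : Y × X → Y} {z : Y} {x : X} (hf : DifferentiableAt ℝ f (z, x)) :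
    HasFDerivAt (fun y => f (y, x)) (partialFst X Y (fderiv ℝ f (z, x))) z :=
  HasFDerivAt.comp (f := fun y => (y, x)) z hf.hasFDerivAt (hasFDerivAt_prodMk_left z x)

/-- The mean value inequality is applied on the slice `{z} ×ˢ univ`, which is convex whether or not
`U` is. -/
theorem IsUniformlyCkOn.norm_sub_snd_le {r : ℕ} {U : Set Y} (hU : IsOpen U)
    {f : ι → Y × X → Y} (hf : IsUniformlyCkOn (r + 1) (U ×ˢ univ) f) :
    ∃ B : ℝ, ∀ p, ∀ z ∈ U, ∀ x y, ‖f p (z, y) - f p (z, x)‖ ≤ B * ‖y - x‖ := by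
  have hW : IsOpen (U ×ˢ (univ : Set X)) := hU.prod isOpen_univ
  obtain ⟨B, hB⟩ := (hf.fderiv_family hW).norm_le
  refine ⟨B, fun p z hz x y => ?_⟩
  have hmem : ∀ q ∈ ({z} ×ˢ univ : Set (Y × X)), q ∈ U ×ˢ (univ : Set X) := by
    rintro ⟨z', x'⟩ ⟨h1, -⟩
    rw [mem_singleton_iff] at h1
    subst h1
    exact ⟨hz, mem_univ _⟩
  have := Convex.norm_image_sub_le_of_norm_fderiv_le
    (𝕜 := ℝ) (fun q hq => hf.differentiableAt hW p (hmem q hq)) (fun q hq => hB p q (hmem q hq))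
    ((convex_singleton z).prod (convex_univ (𝕜 := ℝ) (E := X)))
    (show (z, x) ∈ ({z} ×ˢ univ : Set (Y × X)) from ⟨rfl, mem_univ _⟩)
    (show (z, y) ∈ ({z} ×ˢ univ : Set (Y × X)) from ⟨rfl, mem_univ _⟩)
  simpa [Prod.norm_mk] using this

/-- The partial derivative has a uniform modulus of continuity along segments in the domain. -/
theorem IsUniformlyCkOn.partialFst_modulus {r : ℕ} {U : Set Y} (hU : IsOpen U)
    {f : ι → Y × X → Y} (hf : IsUniformlyCkOn (r + 1) (U ×ˢ univ) f)
    (hmod : r = 0 → ∀ η : ℝ, 0 < η → ∃ δ : ℝ, 0 < δ ∧ ∀ p x, ∀ z ∈ U, ∀ z' ∈ U, ‖z - z'‖ < δ →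
      ‖partialFst X Y (fderiv ℝ (f p) (z, x)) - partialFst X Y (fderiv ℝ (f p) (z', x))‖ ≤ η)
    {η : ℝ} (hη : 0 < η) :
    ∃ δ : ℝ, 0 < δ ∧ ∀ p x z z', segment ℝ z z' ⊆ U → ‖z - z'‖ < δ →
      ‖partialFst X Y (fderiv ℝ (f p) (z, x)) - partialFst X Y (fderiv ℝ (f p) (z', x))‖ ≤ η := by
  rcases r with _ | r
  · obtain ⟨δ, hδ, h⟩ := hmod rfl η hη
    exact ⟨δ, hδ, fun p x z z' hs hz => h p x z (hs (left_mem_segment ℝ z z')) z'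
      (hs (right_mem_segment ℝ z z')) hz⟩
  -- With two bounded derivatives the modulus is a Lipschitz one, by the mean value inequality on
  -- the segment.
  · have hW : IsOpen (U ×ˢ (univ : Set X)) := hU.prod isOpen_univ
    have hf' := hf.fderiv_family hW
    obtain ⟨B, hB⟩ := (hf'.fderiv_family hW).norm_le
    refine ⟨η / (|B| + 1), by positivity, fun p x z z' hs hz => ?_⟩
    have hmem : ∀ q ∈ (segment ℝ z z' ×ˢ {x} : Set (Y × X)), q ∈ U ×ˢ (univ : Set X) :=
      fun q hq => ⟨hs hq.1, mem_univ _⟩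
    have := ((convex_segment z z').prod (convex_singleton x)).norm_image_sub_le_of_norm_fderiv_le
      (𝕜 := ℝ) (fun q hq => hf'.differentiableAt hW p (hmem q hq))
      (fun q hq => hB p q (hmem q hq))
      (show (z', x) ∈ (segment ℝ z z' ×ˢ {x} : Set (Y × X)) from
        ⟨right_mem_segment ℝ z z', rfl⟩)
      (show (z, x) ∈ (segment ℝ z z' ×ˢ {x} : Set (Y × X)) from
        ⟨left_mem_segment ℝ z z', rfl⟩)
    have e : ‖(z, x) - (z', x)‖ = ‖z - z'‖ := by simp [Prod.norm_mk]
    rw [e] at this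
    have hsub : partialFst X Y (fderiv ℝ (f p) (z, x)) - partialFst X Y (fderiv ℝ (f p) (z', x)) =
        partialFst X Y (fderiv ℝ (f p) (z, x) - fderiv ℝ (f p) (z', x)) := by
      simp only [partialFst]
      ext v
      simp
    rw [hsub]
    refine (norm_partialFst_le _).trans (this.trans ?_)
    rw [lt_div_iff₀ (by positivity)] at hz
    have h1 : B * ‖z - z'‖ ≤ |B| * ‖z - z'‖ :=
      mul_le_mul_of_nonneg_right (le_abs_self B) (norm_nonneg _)
    have := norm_nonneg (z - z')
    linarith

/-- Mean value inequality on the segment between two nearby values of the section, along which the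
partial derivative varies by at most `η`. This is where such segments must stay inside `U`. -/
theorem IsUniformlyCkOn.norm_remainder_le {r : ℕ} {U : Set Y} (hU : IsOpen U)
    {f : ι → Y × X → Y} (hf : IsUniformlyCkOn (r + 1) (U ×ˢ univ) f)
    (hmod : r = 0 → ∀ η : ℝ, 0 < η → ∃ δ : ℝ, 0 < δ ∧ ∀ p x, ∀ z ∈ U, ∀ z' ∈ U, ‖z - z'‖ < δ →
      ‖partialFst X Y (fderiv ℝ (f p) (z, x)) - partialFst X Y (fderiv ℝ (f p) (z', x))‖ ≤ η)
    {K : ι → X → Y}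
    (hseg : ∃ ρ : ℝ, 0 < ρ ∧ ∀ p x y, ‖K p y - K p x‖ < ρ → segment ℝ (K p x) (K p y) ⊆ U)
    {η : ℝ} (hη : 0 < η) :
    ∃ δ : ℝ, 0 < δ ∧ ∀ p x y, ‖K p y - K p x‖ ≤ δ →
      ‖f p (K p y, x) - f p (K p x, x) -
        partialFst X Y (fderiv ℝ (f p) (K p x, x)) (K p y - K p x)‖ ≤ η * ‖K p y - K p x‖ := by
  have hW : IsOpen (U ×ˢ (univ : Set X)) := hU.prod isOpen_univ
  obtain ⟨ρ, hρ, hseg⟩ := hseg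
  obtain ⟨δ, hδ, hδm⟩ := hf.partialFst_modulus hU hmod hη
  refine ⟨min ρ δ / 2, by positivity, fun p x y hxy => ?_⟩
  have hlt : ‖K p y - K p x‖ < min ρ δ := by
    have : 0 < min ρ δ := by positivity
    linarith
  have hs := hseg p x y (hlt.trans_le (min_le_left _ _))
  refine Convex.norm_image_sub_le_of_norm_hasFDerivWithin_le' (𝕜 := ℝ)
    (f := fun z => f p (z, x)) (s := segment ℝ (K p x) (K p y))
    (f' := fun z => partialFst X Y (fderiv ℝ (f p) (z, x)))
    (fun z hz => (hasFDerivAt_fst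
      (hf.differentiableAt hW p ⟨hs hz, mem_univ _⟩)).hasFDerivWithinAt) ?_
    (convex_segment _ _) (left_mem_segment ℝ _ _) (right_mem_segment ℝ _ _)
  intro z hz
  refine hδm p x z (K p x) (((convex_segment _ _).segment_subset hz
    (left_mem_segment ℝ _ _)).trans hs) ?_
  have := norm_sub_le_of_mem_segment hz
  exact this.trans_lt (hlt.trans_le (min_le_right _ _))

end Remainder

/-! ### Lifting from the torus to its universal cover. -/

section TorusMaps

variable {m : ℕ}

theorem toTorus_add (x y : Space m) : toTorus (x + y) = toTorus x + toTorus y := by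
  ext i
  simp [toTorus]

/-- The covering map as a homomorphism. -/
noncomputable def toTorusHom (m : ℕ) : Space m →+ Torus m :=
  AddMonoidHom.mk' toTorus toTorus_add

theorem toTorus_nsmul (k : ℕ) (x : Space m) : toTorus (k • x) = k • toTorus x :=
  map_nsmul (toTorusHom m) k x

theorem isOpenQuotientMap_toTorus : IsOpenQuotientMap (toTorus (m := m)) := by
  have h : IsOpenQuotientMap (Pi.map fun (_ : Fin m) (t : ℝ) => (t : UnitAddCircle)) :=
    IsOpenQuotientMap.piMap fun _ => QuotientAddGroup.isOpenQuotientMap_mk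
  exact h.comp (EuclideanSpace.equiv (Fin m) ℝ).toHomeomorph.isOpenQuotientMap

theorem uniformContinuous_comp_toTorus {E : Type*} [NormedAddCommGroup E] {h : Torus m → E}
    (hc : Continuous fun x => h (toTorus x)) : UniformContinuous fun x => h (toTorus x) := by
  have h1 : Continuous h := isOpenQuotientMap_toTorus.isQuotientMap.continuous_iff.2 hc
  have h2 : UniformContinuous (toTorus (m := m)) := by
    have := isOpenQuotientMap_toTorus (m := m)
    exact uniformContinuous_addMonoidHom_of_continuous (f := toTorusHom m) this.continuous
  exact (CompactSpace.uniformContinuous_of_continuous h1).comp h2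

end TorusMaps

/-! ### Two-sided orbits and Poincaré recurrence. -/

section Orbits

variable {Ω : Type*} [MeasurableSpace Ω]

/-- `Φ^k ω` for `k ∈ ℤ`. -/
def orbit (Φ : Ω ≃ᵐ Ω) (k : ℤ) (ω : Ω) : Ω := ((Φ.toEquiv : Equiv.Perm Ω) ^ k) ω

theorem orbit_zero (Φ : Ω ≃ᵐ Ω) (ω : Ω) : orbit Φ 0 ω = ω := rfl

theorem orbit_add (Φ : Ω ≃ᵐ Ω) (j k : ℤ) (ω : Ω) :
    orbit Φ (j + k) ω = orbit Φ j (orbit Φ k ω) := by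
  simp [orbit, zpow_add]

theorem orbit_natCast (Φ : Ω ≃ᵐ Ω) (n : ℕ) : orbit Φ n = Φ^[n] := by
  ext ω
  simp only [orbit, zpow_natCast, Equiv.Perm.coe_pow]
  rfl

theorem orbit_neg_natCast (Φ : Ω ≃ᵐ Ω) (n : ℕ) : orbit Φ (-n) = Φ.symm^[n] := by
  ext ω
  simp only [orbit, zpow_neg, zpow_natCast, ← inv_pow, Equiv.Perm.coe_pow]
  rfl

theorem orbit_succ (Φ : Ω ≃ᵐ Ω) (k : ℤ) (ω : Ω) : orbit Φ (k + 1) ω = Φ (orbit Φ k ω) := by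
  rw [add_comm, orbit_add]
  rfl

variable {P : Measure Ω} {Φ : Ω ≃ᵐ Ω}

theorem measurePreserving_orbit (hΦ : MeasurePreserving Φ P P) (k : ℤ) :
    MeasurePreserving (orbit Φ k) P P := by
  obtain ⟨n, rfl | rfl⟩ := k.eq_nat_or_neg
  · rw [orbit_natCast]
    exact hΦ.iterate n
  · rw [orbit_neg_natCast]
    exact (hΦ.symm Φ).iterate n

theorem ae_forall_orbit (hΦ : MeasurePreserving Φ P P) {p : Ω → Prop} (hp : ∀ᵐ ω ∂P, p ω) :
    ∀ᵐ ω ∂P, ∀ k, p (orbit Φ k ω) :=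
  ae_all_iff.2 fun k => (measurePreserving_orbit hΦ k).quasiMeasurePreserving.ae hp

/-- Recurrence in both time directions. -/
theorem ae_recurrent [IsFiniteMeasure P] (hΦ : MeasurePreserving Φ P P) {S : Set Ω}
    (hS : MeasurableSet S) : ∀ᵐ ω ∂P, ω ∈ S → ∀ k : ℤ, ∃ a ≤ k, ∃ b ≥ k,
      orbit Φ a ω ∈ S ∧ orbit Φ b ω ∈ S := by
  filter_upwards [hΦ.conservative.ae_mem_imp_frequently_image_mem hS.nullMeasurableSet,
    (hΦ.symm Φ).conservative.ae_mem_imp_frequently_image_mem hS.nullMeasurableSet]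
    with ω h1 h2 hω k
  obtain ⟨n1, hn1, hm1⟩ := frequently_atTop.1 (h1 hω) k.natAbs
  obtain ⟨n2, hn2, hm2⟩ := frequently_atTop.1 (h2 hω) k.natAbs
  rw [← orbit_natCast] at hm1
  rw [← orbit_neg_natCast] at hm2
  exact ⟨-n2, by omega, n1, by omega, hm2, hm1⟩

end Orbits

/-! ### Recurrence of a modulus of continuity. -/

section Recurrence

/-- The condition on the points is open and the conclusion closed, so a modulus can be tested on a
countable dense set; this makes the corresponding event measurable. -/
theorem norm_sub_le_of_denseRange {X Y ι : Type*} [NormedAddCommGroup X] [NormedAddCommGroup Y]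
    {d : ι → X} (hd : DenseRange d) {h : X → Y} (hh : Continuous h) {s ε : ℝ}
    (hs : ∀ i j, ‖d j - d i‖ < s → ‖h (d j) - h (d i)‖ ≤ ε) {x y : X} (hxy : ‖y - x‖ < s) :
    ‖h y - h x‖ ≤ ε := by
  have hO : IsOpen {p : X × X | ‖p.2 - p.1‖ < s} :=
    isOpen_lt (by fun_prop) continuous_const
  have hC : IsClosed {p : X × X | ‖h p.2 - h p.1‖ ≤ ε} :=
    isClosed_le (by fun_prop) continuous_const
  have hdense : Dense (range (Prod.map d d)) := hd.prodMap hd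
  have h1 := hdense.open_subset_closure_inter hO (show (x, y) ∈ _ from hxy)
  refine closure_minimal ?_ hC h1
  rintro _ ⟨hp, ⟨i, j⟩, rfl⟩
  exact hs i j hp

variable {Ω : Type*} [MeasurableSpace Ω] {P : Measure Ω} [IsFiniteMeasure P] {Φ : Ω ≃ᵐ Ω}

/-- Almost every orbit of a random field that is uniformly continuous for almost every `ω` returns,
in both time directions, to windows of times with a fixed modulus of continuity. -/
theorem ae_exists_recurrent_windows (hΦ : MeasurePreserving Φ P P) {X Y : Type*}
    [NormedAddCommGroup X] [TopologicalSpace.SeparableSpace X] [NormedAddCommGroup Y]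
    [MeasurableSpace Y] [BorelSpace Y] [SecondCountableTopology Y] {h : Ω → X → Y}
    (hm : ∀ x, Measurable fun ω => h ω x) (hu : ∀ᵐ ω ∂P, UniformContinuous (h ω)) :
    ∀ᵐ ω ∂P, ∀ ε : ℝ, 0 < ε → ∀ N : ℕ, ∃ s : ℝ, 0 < s ∧ ∀ k : ℤ, ∃ a ≤ k, ∃ b ≥ k,
      ∀ j : ℤ, ((j - a).natAbs ≤ N ∨ (j - b).natAbs ≤ N) →
        ∀ x y, ‖y - x‖ < s → ‖h (orbit Φ j ω) y - h (orbit Φ j ω) x‖ ≤ ε := by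
  let d := TopologicalSpace.denseSeq X
  have hd : DenseRange d := TopologicalSpace.denseRange_denseSeq X
  let Q : ℕ → ℕ → Set Ω := fun i l => {ω | ∀ a b, ‖d b - d a‖ < 1 / ((l : ℝ) + 1) →
    ‖h ω (d b) - h ω (d a)‖ ≤ 1 / ((i : ℝ) + 1)}
  have hQ : ∀ i l, MeasurableSet (Q i l) := by
    intro i l
    simp only [Q, ofPred_forall]
    refine MeasurableSet.iInter fun a => MeasurableSet.iInter fun b => MeasurableSet.iInter
      fun _ => measurableSet_le ?_ measurable_const
    exact ((hm _).sub (hm _)).norm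
  -- The modulus is required at all times in `[-N, N]`, so that a visit to this set controls a whole
  -- window.
  let S : ℕ → ℕ → ℕ → Set Ω := fun i N l =>
    ⋂ e ∈ Finset.Icc (-(N : ℤ)) N, orbit Φ e ⁻¹' Q i l
  have hS : ∀ i N l, MeasurableSet (S i N l) := fun i N l =>
    Finset.measurableSet_biInter _ fun e _ => (measurePreserving_orbit hΦ e).measurable (hQ i l)
  have hrec : ∀ᵐ ω ∂P, ∀ i N l, ω ∈ S i N l → ∀ k : ℤ, ∃ a ≤ k, ∃ b ≥ k,
      orbit Φ a ω ∈ S i N l ∧ orbit Φ b ω ∈ S i N l := by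
    simp only [ae_all_iff (ι := ℕ)]
    exact fun i N l => ae_recurrent hΦ (hS i N l)
  filter_upwards [hrec, ae_forall_orbit hΦ hu] with ω hω hcont ε hε N
  obtain ⟨i, hi⟩ := exists_nat_one_div_lt hε
  -- Finitely many uniformly continuous maps share a scale, so `ω` itself belongs to one of these
  -- sets and must return to it. The scale depends on `ω`, `ε` and `N`, but not on `k`.
  obtain ⟨l, hl⟩ : ∃ l, ω ∈ S i N l := by
    have h1 : ∀ e ∈ Finset.Icc (-(N : ℤ)) N, ∀ᶠ l : ℕ in atTop, orbit Φ e ω ∈ Q i l := by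
      intro e _
      obtain ⟨t, ht, htc⟩ := Metric.uniformContinuous_iff.1 (hcont e) (1 / ((i : ℝ) + 1))
        (by positivity)
      filter_upwards [tendsto_one_div_add_atTop_nhds_zero_nat.eventually (gt_mem_nhds ht)]
        with l hl a b hab
      have := htc (a := d b) (b := d a) (by rw [dist_eq_norm]; exact hab.trans hl)
      rw [dist_eq_norm] at this
      exact this.le
    obtain ⟨l, hl⟩ := ((eventually_all_finset _).2 h1).exists
    exact ⟨l, mem_iInter₂.2 hl⟩
  refine ⟨1 / ((l : ℝ) + 1), by positivity, fun k => ?_⟩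
  obtain ⟨a, hak, b, hbk, ha, hb⟩ := hω i N l hl k
  refine ⟨a, hak, b, hbk, fun j hj x y hxy => ?_⟩
  have hjQ : orbit Φ j ω ∈ Q i l := by
    rcases hj with hj | hj
    · have := mem_iInter₂.1 ha (j - a) (Finset.mem_Icc.2 (by omega))
      rwa [mem_preimage, ← orbit_add, sub_add_cancel] at this
    · have := mem_iInter₂.1 hb (j - b) (Finset.mem_Icc.2 (by omega))
      rwa [mem_preimage, ← orbit_add, sub_add_cancel] at this
  exact (norm_sub_le_of_denseRange hd (hcont j).continuous hjQ hxy).trans hi.le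

end Recurrence

/-! ### The cocycle and the skew-product read along an orbit. -/

section Cocycle

variable {Ω : Type*} [MeasurableSpace Ω] {n m : ℕ} {Φ : Ω ≃ᵐ Ω} {α : Space m}
  {M : Torus m → Ω → Space n →L[ℝ] Space n}

theorem forwardCocycle_orbit (x : Space m) (ω : Ω) (k : ℤ) (N : ℕ) :
    forwardCocycle Φ α M (toTorus (x + k • α)) (orbit Φ k ω) N =
      transition (fun j => M (toTorus (x + j • α)) (orbit Φ j ω)) k N := by
  induction N with
  | zero => rfl
  | succ N ih =>
    simp only [forwardCocycle, transition, ih]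
    rw [← toTorus_nsmul, ← toTorus_add, ← orbit_natCast, ← orbit_add, add_comm (N : ℤ) k, add_assoc,
      add_smul, natCast_zsmul]

theorem backwardCocycle_orbit (x : Space m) (ω : Ω) (k : ℤ) (N : ℕ) :
    backwardCocycle Φ α M (toTorus (x + k • α)) (orbit Φ k ω) N =
      transition (timeReversal fun j => M (toTorus (x + j • α)) (orbit Φ j ω)) (-k) N := by
  induction N with
  | zero => rfl
  | succ N ih =>
    simp only [backwardCocycle, transition, ih, timeReversal]
    have e : -(-k + (N : ℤ)) - 1 = -((N + 1 : ℕ) : ℤ) + k := by push_cast; ring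
    have e2 : toTorus (x + k • α) - (N + 1) • toTorus α =
        toTorus (x + (-((N + 1 : ℕ) : ℤ) + k) • α) := by
      rw [sub_eq_iff_eq_add, ← toTorus_nsmul, ← toTorus_add, add_smul, neg_smul, natCast_zsmul]
      congr 1
      abel
    rw [e, orbit_add, orbit_neg_natCast, e2]

theorem cocycle_natCast (θ : Torus m) (ω : Ω) (N : ℕ) :
    cocycle Φ α M θ ω N = forwardCocycle Φ α M θ ω N := rfl

theorem cocycle_neg_natCast (θ : Torus m) (ω : Ω) (N : ℕ) :
    cocycle Φ α M θ ω (-N) = backwardCocycle Φ α M θ ω N := by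
  cases N <;> rfl

end Cocycle

/-- `ContinuousLinearMap.inverse` is zero on non-invertible operators; invertibility makes the
backward cocycle a genuine inverse. -/
theorem isInvertible_fderiv_of_isLocalDiffeomorphAt {E : Type*} [NormedAddCommGroup E]
    [NormedSpace ℝ E] {f : E → E} {z : E} (h : IsLocalDiffeomorphAt 𝓘(ℝ, E) 𝓘(ℝ, E) 1 f z) :
    (fderiv ℝ f z).IsInvertible := by
  refine ⟨h.mfderivToContinuousLinearEquiv one_ne_zero, ?_⟩
  rw [← mfderiv_eq_fderiv]
  rfl

variable {Ω : Type*} [MeasurableSpace Ω] {P : Measure Ω} {Φ : Ω ≃ᵐ Ω} {n m : ℕ}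

/-- The hypotheses on the fibre over a single orbit give a hyperbolic splitting along it. -/
theorem isHyperbolicSplitting_orbit {α : Space m} {M : Torus m → Ω → Space n →L[ℝ] Space n}
    {ES EU : Torus m → Ω → Submodule ℝ (Space n)}
    {projS projU : Torus m → Ω → Space n →L[ℝ] Space n} {C lamS lamU : ℝ}
    (hC : 0 < C) (hS0 : 0 < lamS) (hU1 : 1 < lamU) {ω : Ω}
    (hinv : ∀ (k : ℤ) θ, (M θ (orbit Φ k ω)).IsInvertible)
    (h : ∀ (k : ℤ) (θ : Torus m),
        IsCompl (ES θ (orbit Φ k ω)) (EU θ (orbit Φ k ω)) ∧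
        (∀ v, projS θ (orbit Φ k ω) v ∈ ES θ (orbit Φ k ω) ∧
          projU θ (orbit Φ k ω) v ∈ EU θ (orbit Φ k ω) ∧
          projS θ (orbit Φ k ω) v + projU θ (orbit Φ k ω) v = v) ∧
        (∀ v, v ∈ ES θ (orbit Φ k ω) ↔ ∀ N : ℤ, 0 ≤ N →
          ‖cocycle Φ α M θ (orbit Φ k ω) N v‖ ≤ C * lamS ^ N * ‖v‖) ∧
        (∀ v, v ∈ EU θ (orbit Φ k ω) ↔ ∀ N : ℤ, N ≤ 0 →
          ‖cocycle Φ α M θ (orbit Φ k ω) N v‖ ≤ C * lamU ^ N * ‖v‖) ∧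
        (∀ v ∈ ES θ (orbit Φ k ω),
          M θ (orbit Φ k ω) v ∈ ES (θ + toTorus α) (Φ (orbit Φ k ω))) ∧
        (∀ v ∈ EU θ (orbit Φ k ω),
          M θ (orbit Φ k ω) v ∈ EU (θ + toTorus α) (Φ (orbit Φ k ω)))) (x : Space m) :
    IsHyperbolicSplitting (fun k : ℤ => M (toTorus (x + k • α)) (orbit Φ k ω))
      (fun k => ES (toTorus (x + k • α)) (orbit Φ k ω))
      (fun k => EU (toTorus (x + k • α)) (orbit Φ k ω))
      (fun k => projS (toTorus (x + k • α)) (orbit Φ k ω))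
      (fun k => projU (toTorus (x + k • α)) (orbit Φ k ω)) C (max lamS lamU⁻¹) := by
  have hstep : ∀ k : ℤ, toTorus (x + k • α) + toTorus α = toTorus (x + (k + 1) • α) := fun k => by
    rw [← toTorus_add, add_smul, one_smul, add_assoc]
  have hU0 : 0 < lamU⁻¹ := inv_pos.2 (zero_lt_one.trans hU1)
  refine ⟨fun k => hinv k _, fun k => (h k _).1.disjoint, fun k v => ((h k _).2.1 v).1,
    fun k v => ((h k _).2.1 v).2.1, fun k v => ((h k _).2.1 v).2.2, ?_, ?_, ?_, ?_⟩
  · intro k v hv N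
    have := ((h k _).2.2.1 v).1 hv N (by omega)
    rw [cocycle_natCast, forwardCocycle_orbit, zpow_natCast] at this
    refine this.trans (mul_le_mul_of_nonneg_right (mul_le_mul_of_nonneg_left ?_ hC.le)
      (norm_nonneg _))
    exact pow_le_pow_left₀ hS0.le (le_max_left _ _) N
  · intro k v hv N
    have := ((h k _).2.2.2.1 v).1 hv (-(N : ℤ)) (by omega)
    rw [cocycle_neg_natCast, backwardCocycle_orbit, zpow_neg, zpow_natCast, ← inv_pow] at this
    refine this.trans (mul_le_mul_of_nonneg_right (mul_le_mul_of_nonneg_left ?_ hC.le)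
      (norm_nonneg _))
    exact pow_le_pow_left₀ hU0.le (le_max_right _ _) N
  · intro k v hv
    have := (h k _).2.2.2.2.1 v hv
    rwa [hstep, ← orbit_succ] at this
  · intro k v hv
    have := (h k _).2.2.2.2.2 v hv
    rwa [hstep, ← orbit_succ] at this

/-- The skew-product along an orbit, with `θ` seen as a parameter in `ℝᵐ`. -/
def orbitMap (Φ : Ω ≃ᵐ Ω) (α : Space m) (F : Space n → Torus m → Ω → Space n) (ω : Ω) (k : ℤ)
    (p : Space n × Space m) : Space n :=
  F p.1 (toTorus (p.2 + k • α)) (orbit Φ k ω)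

/-- The section `K` along an orbit, with `θ` seen as a parameter in `ℝᵐ`. -/
def orbitSection (Φ : Ω ≃ᵐ Ω) (α : Space m) (K : Torus m → Ω → Space n) (ω : Ω) (k : ℤ)
    (x : Space m) : Space n :=
  K (toTorus (x + k • α)) (orbit Φ k ω)

theorem isUniformlyCkOn_orbitMap {κ : Type*} {ω : κ → Ω} {U : Set (Space n)} {α : Space m}
    {F : Space n → Torus m → Ω → Space n} {r : ℕ} {B : ℝ}
    (h1 : ∀ c k, ContDiffOn ℝ r
      (fun p : Space n × Space m => F p.1 (toTorus p.2) (orbit Φ k (ω c))) (U ×ˢ univ))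
    (h2 : ∀ c k, ∀ j : ℕ, j ≤ r → ∀ z ∈ U, ∀ x : Space m, ‖iteratedFDeriv ℝ j
      (fun p : Space n × Space m => F p.1 (toTorus p.2) (orbit Φ k (ω c))) (z, x)‖ ≤ B) :
    IsUniformlyCkOn r (U ×ˢ univ) fun p : κ × ℤ => orbitMap Φ α F (ω p.1) p.2 := by
  -- The rotation is a translation in the lifted variable, so derivative bounds are unchanged.
  have e : ∀ (c : κ) (k : ℤ), orbitMap Φ α F (ω c) k = fun p : Space n × Space m =>
      (fun p : Space n × Space m => F p.1 (toTorus p.2) (orbit Φ k (ω c)))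
        (p + ((0, k • α) : Space n × Space m)) := by
    intro c k
    ext1 p
    simp [orbitMap]
  refine ⟨fun ⟨c, k⟩ => ?_, B, fun ⟨c, k⟩ j hj => ?_⟩
  · change ContDiffOn ℝ r (orbitMap Φ α F (ω c) k) _
    rw [e]
    refine (h1 c k).comp (contDiff_id.add contDiff_const).contDiffOn ?_
    rintro ⟨z, x⟩ ⟨hz, -⟩
    exact ⟨by simpa using hz, mem_univ _⟩
  · rintro ⟨z, x⟩ ⟨hz, -⟩
    change ‖iteratedFDeriv ℝ j (orbitMap Φ α F (ω c) k) (z, x)‖ ≤ B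
    rw [e]
    have h3 := iteratedFDeriv_comp_add_right (𝕜 := ℝ)
      (f := fun p : Space n × Space m => F p.1 (toTorus p.2) (orbit Φ k (ω c))) j
      ((0, k • α) : Space n × Space m) (z, x)
    refine (congrArg norm h3).trans_le ?_
    have := h2 c k j hj z hz (x + k • α)
    simpa using this

theorem orbitSection_succ {α : Space m} {F : Space n → Torus m → Ω → Space n}
    {K : Torus m → Ω → Space n} {ω : Ω}
    (h : ∀ (k : ℤ) θ, F (K θ (orbit Φ k ω)) θ (orbit Φ k ω) =
      K (θ + toTorus α) (Φ (orbit Φ k ω))) (k : ℤ) (x : Space m) :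
    orbitSection Φ α K ω (k + 1) x = orbitMap Φ α F ω k (orbitSection Φ α K ω k x, x) := by
  simp only [orbitSection, orbitMap, h, orbit_succ]
  rw [← toTorus_add, add_smul, one_smul, add_assoc]

theorem fderiv_eq_partialFst_orbitMap {α : Space m} {F : Space n → Torus m → Ω → Space n} {ω : Ω}
    {k : ℤ} {z : Space n} {x : Space m}
    (h : DifferentiableAt ℝ (orbitMap Φ α F ω k) (z, x)) :
    fderiv ℝ (fun y => F y (toTorus (x + k • α)) (orbit Φ k ω)) z =
      partialFst (Space m) (Space n) (fderiv ℝ (orbitMap Φ α F ω k) (z, x)) :=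
  (hasFDerivAt_fst h).fderiv

end RandomTorus

/-! ### The theorem: choice of a full-measure set and assembly. -/

open RandomTorus

theorem mainTheorem3 {Ω : Type*} [MeasurableSpace Ω] (P : Measure Ω) [IsProbabilityMeasure P]
    (Φ : Ω ≃ᵐ Ω) (hΦ : MeasurePreserving Φ P P)
    {n m : ℕ} (α : RandomTorus.Space m) (r : ℕ)
    (U : Set (RandomTorus.Space n)) (hU : IsOpen U)
    (F : RandomTorus.Space n → RandomTorus.Torus m → Ω → RandomTorus.Space n)
    (hF : RandomTorus.IsLinftyCrOn P r U F)
    (hF1 : r = 1 → RandomTorus.HasUniformModulusFDeriv P U F)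
    (hdiffeo : ∀ᵐ ω ∂P, ∀ θ : RandomTorus.Torus m,
      IsLocalDiffeomorphOn 𝓘(ℝ, RandomTorus.Space n) 𝓘(ℝ, RandomTorus.Space n) 1
        (fun z => F z θ ω) U)
    (K : RandomTorus.Torus m → Ω → RandomTorus.Space n)
    (hK : RandomTorus.IsLinftyCr P 0 K)
    (hKU : ∀ᵐ ω ∂P, ∀ θ : RandomTorus.Torus m, K θ ω ∈ U)
    (hdist : Convex ℝ U ∨
      ∃ ρ : ℝ, 0 < ρ ∧ ∀ᵐ ω ∂P, ∀ θ : RandomTorus.Torus m, Metric.ball (K θ ω) ρ ⊆ U)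
    (hNH : RandomTorus.IsNormallyHyperbolicInvariantTorus P Φ α F K) :
    RandomTorus.IsLinftyCr P r K := by
  rcases r with _ | r
  · exact hK
  obtain ⟨hKm, hKc, BK, hKB⟩ := hK
  obtain ⟨-, hFc, BF, hFB⟩ := hF
  obtain ⟨hinvar, ES, EU, projS, projU, C, lamS, lamU, hC, hS0, hS1, hU1, -, -, hsplit⟩ := hNH
  -- countably many moduli
  have hmodulus : ∃ δ : ℕ → ℝ, (∀ i, 0 < δ i) ∧ ∀ᵐ ω ∂P, ∀ i, r = 0 → ∀ θ : Torus m,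
      ∀ z ∈ U, ∀ z' ∈ U, ‖z - z'‖ < δ i →
        ‖fderiv ℝ (fun y => F y θ ω) z - fderiv ℝ (fun y => F y θ ω) z'‖ ≤ 1 / ((i : ℝ) + 1) := by
    by_cases hr : r = 0
    · choose δ hδ h using fun i : ℕ => hF1 (by rw [hr]) (1 / ((i : ℝ) + 1)) (by positivity)
      refine ⟨δ, hδ, ?_⟩
      filter_upwards [ae_all_iff.2 h] with ω hω i _ using hω i
    · exact ⟨fun _ => 1, fun _ => one_pos, Eventually.of_forall fun ω i h => (hr h).elim⟩
  obtain ⟨δ, hδ, hmodulus⟩ := hmodulus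
  -- The two alternatives on `U` enter only through this consequence.
  have hsegment : ∃ ρ : ℝ, 0 < ρ ∧ ∀ᵐ ω ∂P, (∀ θ, K θ ω ∈ U) → ∀ θ θ', ‖K θ' ω - K θ ω‖ < ρ →
      segment ℝ (K θ ω) (K θ' ω) ⊆ U := by
    rcases hdist with hconv | ⟨ρ, hρ, hball⟩
    · exact ⟨1, one_pos, Eventually.of_forall fun ω h θ θ' _ =>
        hconv.segment_subset (h θ) (h θ')⟩
    · refine ⟨ρ, hρ, ?_⟩
      filter_upwards [hball] with ω hω _ θ θ' hθ
      refine ((convex_ball (K θ ω) ρ).segment_subset (Metric.mem_ball_self hρ) ?_).trans (hω θ)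
      rwa [Metric.mem_ball, dist_eq_norm]
  obtain ⟨ρ, hρ, hsegment⟩ := hsegment
  have hrecur := ae_exists_recurrent_windows hΦ (h := fun ω (x : Space m) => K (toTorus x) ω)
    (fun x => hKm.comp (measurable_const.prodMk measurable_id))
    (hKc.mono fun ω hω => uniformContinuous_comp_toTorus (h := fun θ => K θ ω) hω.continuous)
  -- All good orbits together index one family, so every constant obtained below is independent of
  -- `ω`.
  obtain ⟨S, hS, hSgood⟩ := ((ae_forall_orbit hΦ (hKc.and (hKB.and (hFc.and (hFB.and (hinvar.and
    (hsplit.and (hdiffeo.and (hKU.and (hmodulus.and hsegment)))))))))).and hrecur).exists_mem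
  have gU : ∀ (c : S) k θ, K θ (orbit Φ k c) ∈ U := fun c k =>
    ((hSgood c c.2).1 k).2.2.2.2.2.2.2.1
  have hW : IsOpen (U ×ˢ (univ : Set (Space m))) := hU.prod isOpen_univ
  set f : S × ℤ → Space n × Space m → Space n := fun p => orbitMap Φ α F p.1 p.2 with hfdef
  set k' : S × ℤ → Space m → Space n := fun p => orbitSection Φ α K p.1 p.2 with hk'def
  have hf : IsUniformlyCkOn (r + 1) (U ×ˢ univ) f :=
    isUniformlyCkOn_orbitMap (ω := fun c : S => (c : Ω))
      (fun c k => ((hSgood c c.2).1 k).2.2.1) (fun c k => ((hSgood c c.2).1 k).2.2.2.1)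
  have hk'U : ∀ p x, k' p x ∈ U := fun p x => gU p.1 p.2 _
  have hdiff : ∀ (p : S × ℤ) z, z ∈ U → ∀ x, DifferentiableAt ℝ (orbitMap Φ α F p.1 p.2) (z, x) :=
    fun p z hz x => hf.differentiableAt hW p ⟨hz, mem_univ _⟩
  have hUC : ∀ p, UniformContinuous (k' p) := fun p =>
    (uniformContinuous_comp_toTorus (h := fun θ => K θ (orbit Φ p.2 p.1))
      ((hSgood p.1 p.1.2).1 p.2).1.continuous).comp (uniformContinuous_id.add_const _)
  have hk'B : ∀ p x, ‖k' p x‖ ≤ BK := fun p x => by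
    have := ((hSgood p.1 p.1.2).1 p.2).2.1 0 le_rfl (x + p.2 • α)
    rwa [norm_iteratedFDeriv_zero] at this
  have heq : ∀ c k x, k' (c, k + 1) x = f (c, k) (k' (c, k) x, x) := fun c k x =>
    orbitSection_succ (fun k => ((hSgood c c.2).1 k).2.2.2.2.1) k x
  have hM : ∀ (c : S) (k : ℤ) x, transferMatrix F K (toTorus (x + k • α)) (orbit Φ k c) =
      partialFst (Space m) (Space n) (fderiv ℝ (f (c, k)) (k' (c, k) x, x)) := fun c k x =>
    fderiv_eq_partialFst_orbitMap (hdiff (c, k) _ (hk'U (c, k) x) x)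
  obtain ⟨BD, hBD⟩ := (hf.fderiv_family hW).norm_le
  have hA : ∀ p x, ‖partialFst (Space m) (Space n) (fderiv ℝ (f p) (k' p x, x))‖ ≤ BD :=
    fun p x => (norm_partialFst_le _).trans (hBD p _ ⟨hk'U p x, mem_univ _⟩)
  have hμ0 : 0 < max lamS lamU⁻¹ := lt_max_of_lt_left hS0
  have hμ1 : max lamS lamU⁻¹ < 1 := max_lt hS1 (inv_lt_one_of_one_lt₀ hU1)
  obtain ⟨C', hC'⟩ := exists_isDichotomous_of_splitting (E := Space n) (b := BD) hC.le hμ0 hμ1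
  have hD : ∀ c x, IsDichotomous (fun k => partialFst (Space m) (Space n)
      (fderiv ℝ (f (c, k)) (k' (c, k) x, x))) C' (max lamS lamU⁻¹) := by
    intro c x
    have h1 := isHyperbolicSplitting_orbit (M := transferMatrix F K) (ω := c) hC hS0 hU1
      (fun k θ => isInvertible_fderiv_of_isLocalDiffeomorphAt
        (((hSgood c c.2).1 k).2.2.2.2.2.2.1 θ ⟨_, gU c k θ⟩))
      (fun k => ((hSgood c c.2).1 k).2.2.2.2.2.1.2.2) x
    have h2 := hC' _ _ _ _ _ h1 (fun k => by rw [hM]; exact hA (c, k) x)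
    have e : (fun k : ℤ => transferMatrix F K (toTorus (x + k • α)) (orbit Φ k c)) =
        fun k => partialFst (Space m) (Space n) (fderiv ℝ (f (c, k)) (k' (c, k) x, x)) := by
      ext1 k
      exact hM c k x
    rwa [e] at h2
  have hseg : ∃ ρ : ℝ, 0 < ρ ∧ ∀ p x y, ‖k' p y - k' p x‖ < ρ →
      segment ℝ (k' p x) (k' p y) ⊆ U :=
    ⟨ρ, hρ, fun p x y => ((hSgood p.1 p.1.2).1 p.2).2.2.2.2.2.2.2.2.2 (gU p.1 p.2) _ _⟩
  have hmod : r = 0 → ∀ η : ℝ, 0 < η → ∃ δ : ℝ, 0 < δ ∧ ∀ p x, ∀ z ∈ U, ∀ z' ∈ U, ‖z - z'‖ < δ →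
      ‖partialFst (Space m) (Space n) (fderiv ℝ (f p) (z, x)) -
        partialFst (Space m) (Space n) (fderiv ℝ (f p) (z', x))‖ ≤ η := by
    intro hr η hη
    obtain ⟨i, hi⟩ := exists_nat_one_div_lt hη
    refine ⟨δ i, hδ i, fun p x z hz z' hz' hzz => ?_⟩
    have := ((hSgood p.1 p.1.2).1 p.2).2.2.2.2.2.2.2.2.1 i hr (toTorus (x + p.2 • α)) z hz z' hz' hzz
    rw [fderiv_eq_partialFst_orbitMap (hdiff p z hz x),
      fderiv_eq_partialFst_orbitMap (hdiff p z' hz' x)] at this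
    exact this.trans hi.le
  obtain ⟨B, hB⟩ := hf.norm_sub_snd_le hU
  obtain ⟨L, hL⟩ := exists_uniform_lipschitz hk'B hA heq hD
    (fun p x y => hB p _ (hk'U p y) x y)
    (fun η hη => hf.norm_remainder_le hU hmod hseg hη) hUC (fun ε hε N c => by
      obtain ⟨s, hs, hrec⟩ := (hSgood c c.2).2 ε hε N
      refine ⟨s, hs, fun k => ?_⟩
      obtain ⟨a, ha, b, hb, hab⟩ := hrec k
      refine ⟨a, ha, b, hb, fun j hj x y hxy => ?_⟩
      exact hab j hj (x + j • α) (y + j • α) (by rwa [add_sub_add_right_eq_sub]))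
  have hLip : ∀ c x, ∀ᶠ y in 𝓝 x, ∀ k, ‖k' (c, k) y - k' (c, k) x‖ ≤ L * ‖y - x‖ := by
    intro c x
    obtain ⟨s, hs, hsL⟩ := hL c
    filter_upwards [Metric.ball_mem_nhds x hs] with y hy
    exact hsL x y (by rwa [Metric.mem_ball, dist_eq_norm] at hy)
  obtain ⟨hCk, B', hB'⟩ := isUniformlyCk_of_invariant hU hf
    (isUniformlyCk_zero.2 ⟨fun p => (hUC p).continuous, BK, hk'B⟩) hk'U heq hD hLip (r + 1) le_rfl
  -- The original map is recovered as the member of the family at time zero.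
  have e0 : ∀ c : S, k' (c, 0) = fun x => K (toTorus x) c := fun c => by
    ext1 x
    simp only [hk'def, orbitSection, zero_smul, add_zero, orbit_zero]
  refine ⟨hKm, ?_, B', ?_⟩
  · filter_upwards [hS] with ω hω
    rw [← e0 ⟨ω, hω⟩]
    exact hCk _
  · filter_upwards [hS] with ω hω
    rw [← e0 ⟨ω, hω⟩]
    exact hB' _
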